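/- **Theorem.** Let $n\ge 1$, let $\langle\cdot,\cdot\rangle$ and $\|\cdot\|$ be the standard inner product and norm on $\mathbb R^n$, and let $B_2^n=\{x\in\mathbb R^n:\|x\|\le 1\}$. Let $K\subseteq\mathbb R^n$ be a symmetric convex body, that is, a compact convex set with nonempty interior such that $K=-K$, and let $K^\circ=\{x\in\mathbb R^n:\langle x,y\rangle\le 1\ \text{for all } y\in K\}$ be its polar body. A symmetric convex body $L\subseteq\mathbb R^n$ is called isotropic if $$\int_L\langle x,w\rangle^2\,dx=\frac{\|w\|^2}{n}\int_L\|x\|^2\,dx\qquad\text{for all } w\in\mathbb R^n$$ (no normalization of the volume of $L$ is required). Suppose that at least one of $K$ and $K^\circ$ is isotropic, and let $u\in\mathbb R^n\setminus\{0\}$. Then $$\int_K\langle x,u\rangle^2\,dx\int_{K^\circ}\langle x,u\rangle^2\,dx\le\left(\int_{B_2^n}\langle x,u\rangle^2\,dx\right)^2,$$ with equality if and only if $K$ is a Euclidean ball centered at the origin, i.e. $K=\{x\in\mathbb R^n:\|x\|\le r\}$ for some $r>0$. -/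

import Mathlib

open MeasureTheory

open scoped Pointwise

/-- `K` is a symmetric convex body in `ℝⁿ`: a compact convex set with nonempty interior such that
`K = -K`. -/
structure IsSymmetricConvexBody {n : ℕ} (K : Set (EuclideanSpace ℝ (Fin n))) : Prop where
  convex : Convex ℝ K
  isCompact : IsCompact K
  interior_nonempty : (interior K).Nonempty
  symmetric : K = -K

/-- The polar body `K° = {x : ⟨x, y⟩ ≤ 1 for all y ∈ K}`. -/
def polarBody {n : ℕ} (K : Set (EuclideanSpace ℝ (Fin n))) : Set (EuclideanSpace ℝ (Fin n)) :=
  {x | ∀ y ∈ K, inner ℝ x y ≤ 1}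

/-- `L` is isotropic: `∫_L ⟨x, u⟩² dx = (‖u‖² / n) ∫_L ‖x‖² dx` for all `u`. No normalization of
the volume of `L` is required. -/
def IsIsotropicBody {n : ℕ} (L : Set (EuclideanSpace ℝ (Fin n))) : Prop :=
  ∀ u : EuclideanSpace ℝ (Fin n),
    ∫ x in L, (inner ℝ x u) ^ 2 = ‖u‖ ^ 2 / (n : ℝ) * ∫ x in L, ‖x‖ ^ 2

/-!
The proof bounds, for a direction `u`, the product of the second moments of the halves `⟨x, u⟩ > 0`
of `K` and of its polar body. Write `x = (t, x')` with `t = ⟨x, u⟩ / ‖u‖`. If `K` is isotropic, then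
`∫ t x' = 0` over the half `t > 0` of `K`, and this barycenter condition is all that is used of
isotropy.

The inequality is proved in a functional form (`SantaloInequality`), for functions `A`, `B` on the
half-space `t > 0` of `ℝ × V` with `A(v) B(w) ≤ θ(⟨v, w⟩)²` where the pairing is positive and with
`∫ t x A(t, x) = 0`: then `∫ t² A ∫ t² B ≤ (∫ t² θ(|v|²))²`. The proof is by induction on the
dimension of `V`, in the manner of Lehec's proof of the functional Santaló inequality.

* In dimension `0` this is the Prékopa–Leindler inequality on `(0, ∞)` with multiplicative means
  (`integral_mul_integral_le_sq_integral_sqrt`), which is proved by a monotone coupling.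
* For the inductive step a hyperplane of the form `x₁ = a t` is chosen which halves `∫ t² A`, and
  `A` is integrated on both sides of it along lines joining the barycenters of the two halves, while
  `B` is integrated along the dual direction. By the one-dimensional inequality the partial integrals
  are again in duality, for the kernel `w ↦ ∫ θ(w + r²) dr`, and the barycenter condition holds after
  a shear `(t, x) ↦ (t, x - t z)` (`santaloBound_half`, `exists_center`).
* That argument produces a center `z` instead of using the one that is given. Applied to `B`, it is
  turned into the statement with the barycenter condition on `A` by the dual shear
  `(t, x) ↦ (t + ⟨z, x⟩, x)`, which does not decrease `∫ t² A` since `(t + r)₊² ≥ t² + 2 t r` for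
  `t > 0` and the linear term integrates to zero (`santaloInequality_prod`).

For the case of equality the induction also carries along a second statement: if the inequality for
the second moments is an equality, then the masses satisfy `∫ A ∫ B ≥ (∫ θ(|v|²))²`. In dimension `0`
equality determines the law of the coupling, and the statement becomes the Cauchy–Schwarz inequality.
For bodies it says that equality in one direction `u` forces `vol K vol K° ≥ (vol B)²`. On the other
hand, summing the inequality over an orthonormal basis gives
`∫_K ‖x‖² ∫_{K°} ‖x‖² ≤ (∫_B ‖x‖²)²`, while balls are the unique minimizers of `∫ ‖x‖²` for given
volume. Hence `K` is a ball (`IsSymmetricConvexBody.eq_closedBall`).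
-/

section BlaschkeSantalo

open Set Filter ProbabilityTheory

/-! ### The Prékopa–Leindler inequality on the half-line -/

/-- The quantile function of a measure on the line: the generalized inverse of its distribution
function. It is meaningful on the interval `(0, 1)` only. -/
noncomputable def quantile (μ : Measure ℝ) (τ : ℝ) : ℝ :=
  sInf {a | τ ≤ cdf μ a}

lemma quantile_le_iff (μ : Measure ℝ) [IsProbabilityMeasure μ] {τ : ℝ} (hτ : τ ∈ Ioo (0 : ℝ) 1)
    (a : ℝ) : quantile μ τ ≤ a ↔ τ ≤ cdf μ a := by
  have hbdd : BddBelow {a | τ ≤ cdf μ a} := by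
    obtain ⟨c, hc⟩ := ((tendsto_cdf_atBot μ).eventually (gt_mem_nhds hτ.1)).exists
    refine ⟨c, fun b hb => ?_⟩
    by_contra hlt
    exact absurd (hb.trans (monotone_cdf μ (not_le.1 hlt).le)) (not_le.2 hc)
  have hne : {a | τ ≤ cdf μ a}.Nonempty := by
    obtain ⟨c, hc⟩ := ((tendsto_cdf_atTop μ).eventually (lt_mem_nhds hτ.2)).exists
    exact ⟨c, hc.le⟩
  refine ⟨fun h => ?_, fun h => csInf_le hbdd h⟩
  -- by right continuity the infimum is attained
  have hright := ((cdf μ).right_continuous a).mono Ioi_subset_Ici_self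
  refine ge_of_tendsto hright ?_
  filter_upwards [self_mem_nhdsWithin] with b hb
  obtain ⟨c, hc, hcb⟩ := (csInf_lt_iff hbdd hne).1 (h.trans_lt hb)
  exact le_trans hc (monotone_cdf μ hcb.le)

lemma monotoneOn_quantile (μ : Measure ℝ) [IsProbabilityMeasure μ] :
    MonotoneOn (quantile μ) (Ioo 0 1) := fun _ hσ _ hτ hστ =>
  (quantile_le_iff μ hσ _).2 (hστ.trans ((quantile_le_iff μ hτ _).1 le_rfl))

lemma aemeasurable_quantile (μ : Measure ℝ) [IsProbabilityMeasure μ] :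
    AEMeasurable (quantile μ) (volume.restrict (Ioo 0 1)) :=
  aemeasurable_restrict_of_monotoneOn measurableSet_Ioo (monotoneOn_quantile μ)

lemma map_quantile (μ : Measure ℝ) [IsProbabilityMeasure μ] :
    (volume.restrict (Ioo 0 1)).map (quantile μ) = μ := by
  have : IsFiniteMeasure ((volume.restrict (Ioo (0 : ℝ) 1)).map (quantile μ)) := inferInstance
  refine Measure.ext_of_Iic _ _ fun a => ?_
  rw [Measure.map_apply_of_aemeasurable (aemeasurable_quantile μ) measurableSet_Iic,
    Measure.restrict_apply₀' measurableSet_Ioo.nullMeasurableSet, ← ofReal_cdf]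
  have hset : quantile μ ⁻¹' Iic a ∩ Ioo 0 1 = Iic (cdf μ a) ∩ Ioo 0 1 := by
    ext τ
    refine and_congr_left fun hτ => ?_
    simpa using quantile_le_iff μ hτ a
  rw [hset]
  refine le_antisymm ?_ ?_
  · calc volume (Iic (cdf μ a) ∩ Ioo 0 1) ≤ volume (Ioc 0 (cdf μ a)) :=
          measure_mono fun τ hτ => ⟨hτ.2.1, hτ.1⟩
      _ = _ := by simp
  · calc ENNReal.ofReal (cdf μ a) = volume (Ioo 0 (cdf μ a)) := by simp
      _ ≤ volume (Iic (cdf μ a) ∩ Ioo 0 1) :=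
          measure_mono fun τ hτ => ⟨hτ.2.le, hτ.1, hτ.2.trans_le (cdf_le_one μ a)⟩

lemma cdf_quantile (μ : Measure ℝ) [IsProbabilityMeasure μ] [NullSingletonClass μ] {τ : ℝ}
    (hτ : τ ∈ Ioo (0 : ℝ) 1) : cdf μ (quantile μ τ) = τ := by
  refine le_antisymm ?_ ((quantile_le_iff μ hτ _).1 le_rfl)
  set a := quantile μ τ with ha
  have h0 : (cdf μ).measure {a} = 0 := by rw [measure_cdf]; exact measure_singleton a
  rw [StieltjesFunction.measure_singleton, ENNReal.ofReal_eq_zero, sub_nonpos] at h0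
  refine h0.trans (le_of_tendsto ((monotone_cdf μ).tendsto_leftLim a) ?_)
  filter_upwards [self_mem_nhdsWithin] with b hb
  by_contra hlt
  exact absurd ((quantile_le_iff μ hτ b).2 (not_le.1 hlt).le) (not_le.2 hb)

/-- The quantile function of an absolutely continuous law with density `g` satisfies
`q' = 1 / g(q)` almost everywhere. -/
lemma ae_hasDerivAt_quantile (μ : Measure ℝ) [IsProbabilityMeasure μ] {g : ℝ → ENNReal}
    (hg : Measurable g) (hμ : μ = volume.withDensity g) :
    ∀ᵐ τ ∂(volume.restrict (Ioo (0 : ℝ) 1)), HasDerivAt (quantile μ) (deriv (quantile μ) τ) τ ∧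
      0 < deriv (quantile μ) τ ∧ ENNReal.ofReal (deriv (quantile μ) τ) * g (quantile μ τ) = 1 := by
  have hac : μ ≪ volume := by rw [hμ]; exact withDensity_absolutelyContinuous _ _
  have : NullSingletonClass μ := ⟨fun x => hac (measure_singleton x)⟩
  have h1 : ∀ᵐ x, HasDerivAt (cdf μ) (g x).toReal x := by
    have h2 : μ.rnDeriv volume =ᵐ[volume] g := by
      conv_lhs => rw [hμ]
      exact Measure.rnDeriv_withDensity _ hg
    filter_upwards [(cdf μ).ae_hasDerivAt, h2] with x hx hx2
    rwa [measure_cdf, hx2] at hx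
  have h3 : ∀ᵐ τ ∂(volume.restrict (Ioo (0 : ℝ) 1)),
      HasDerivAt (cdf μ) (g (quantile μ τ)).toReal (quantile μ τ) := by
    refine ae_of_ae_map (p := fun a => HasDerivAt (cdf μ) (g a).toReal a)
      (aemeasurable_quantile μ) ?_
    rw [map_quantile]
    exact hac.ae_le h1
  filter_upwards [h3, (monotoneOn_quantile μ).ae_differentiableWithinAt measurableSet_Ioo,
    ae_restrict_mem measurableSet_Ioo] with τ hτ hd hm
  have hd' : DifferentiableAt ℝ (quantile μ) τ :=
    hd.differentiableAt (isOpen_Ioo.mem_nhds hm)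
  have hcomp := hτ.comp τ hd'.hasDerivAt
  have hid : HasDerivAt (cdf μ ∘ quantile μ) 1 τ := by
    refine (hasDerivAt_id τ).congr_of_eventuallyEq ?_
    filter_upwards [isOpen_Ioo.mem_nhds hm] with σ hσ
    exact cdf_quantile μ hσ
  have h1 := hcomp.unique hid
  have hpos : 0 < deriv (quantile μ) τ := by
    by_contra hneg
    have := mul_nonpos_of_nonneg_of_nonpos (ENNReal.toReal_nonneg (a := g (quantile μ τ)))
      (not_lt.1 hneg)
    linarith
  refine ⟨hd'.hasDerivAt, hpos, ?_⟩
  have htop : g (quantile μ τ) ≠ ⊤ := by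
    intro h; rw [h] at h1; simp at h1
  rw [← ENNReal.ofReal_toReal htop, ← ENNReal.ofReal_mul hpos.le, mul_comm, h1,
    ENNReal.ofReal_one]

/-- **A transport form of the Prékopa–Leindler inequality on the half-line**, multiplicative in the
variables. If `g₁(a) g₂(b) ≤ k(√(ab))²` for probability densities `g₁`, `g₂` on `(0, ∞)`, then the
law of the geometric mean of the monotone coupling is bounded by the measure with density `k`. -/
lemma map_sqrt_quantile_mul_le (μ ν : Measure ℝ) [IsProbabilityMeasure μ] [IsProbabilityMeasure ν]
    {g₁ g₂ k : ℝ → ENNReal} (hg₁ : Measurable g₁) (hg₂ : Measurable g₂)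
    (hμ : μ = volume.withDensity g₁) (hν : ν = volume.withDensity g₂)
    (h₁ : ∀ a ≤ 0, g₁ a = 0) (h₂ : ∀ a ≤ 0, g₂ a = 0)
    (h : ∀ a b, 0 < a → 0 < b → g₁ a * g₂ b ≤ k (√(a * b)) ^ 2) :
    (volume.restrict (Ioo 0 1)).map (fun τ => √(quantile μ τ * quantile ν τ)) ≤
      (volume.restrict (Ioi 0)).withDensity k := by
  set x := quantile μ with hx
  set y := quantile ν with hy
  set z : ℝ → ℝ := fun τ => √(x τ * y τ) with hz
  have hzm : AEMeasurable z (volume.restrict (Ioo 0 1)) :=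
    ((aemeasurable_quantile μ).mul (aemeasurable_quantile ν)).sqrt
  have hac : μ ≪ volume := by rw [hμ]; exact withDensity_absolutelyContinuous _ _
  have : NullSingletonClass μ := ⟨fun x => hac (measure_singleton x)⟩
  have hac' : ν ≪ volume := by rw [hν]; exact withDensity_absolutelyContinuous _ _
  have : NullSingletonClass ν := ⟨fun x => hac' (measure_singleton x)⟩
  -- a measurable set of full measure on which everything is differentiable
  obtain ⟨s, hsub, hsm, hs⟩ : ∃ s ⊆ Ioo (0 : ℝ) 1, MeasurableSet s ∧
      volume.restrict (Ioo (0 : ℝ) 1) = volume.restrict s ∧ ∀ τ ∈ s,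
        (HasDerivAt x (deriv x τ) τ ∧ 0 < deriv x τ ∧ ENNReal.ofReal (deriv x τ) * g₁ (x τ) = 1) ∧
        (HasDerivAt y (deriv y τ) τ ∧ 0 < deriv y τ ∧
          ENNReal.ofReal (deriv y τ) * g₂ (y τ) = 1) := by
    have hae := (ae_hasDerivAt_quantile μ hg₁ hμ).and (ae_hasDerivAt_quantile ν hg₂ hν)
    obtain ⟨t, hts, htm, ht⟩ := exists_measurable_superset_of_null (ae_iff.1 hae)
    refine ⟨Ioo 0 1 \ t, sdiff_subset, measurableSet_Ioo.diff htm, ?_, fun τ hτ => ?_⟩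
    · rw [Measure.restrict_apply htm, inter_comm] at ht
      refine (Measure.restrict_congr_set ?_).symm
      rw [← sdiff_self_inter]
      exact sdiff_null_ae_eq_self ht
    · by_contra hcon
      exact hτ.2 (hts hcon)
  obtain ⟨hres, hs⟩ := hs
  have hposx : ∀ τ ∈ s, 0 < x τ := fun τ hτ => by
    by_contra hneg
    have := (hs τ hτ).1.2.2
    rw [h₁ _ (not_lt.1 hneg)] at this
    simp at this
  have hposy : ∀ τ ∈ s, 0 < y τ := fun τ hτ => by
    by_contra hneg
    have := (hs τ hτ).2.2.2
    rw [h₂ _ (not_lt.1 hneg)] at this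
    simp at this
  have hxmono : StrictMonoOn x (Ioo 0 1) :=
    (monotoneOn_quantile μ).strictMonoOn_of_injOn fun σ hσ τ hτ hst => by
      rw [← cdf_quantile μ hσ, ← cdf_quantile μ hτ]; exact congrArg _ hst
  have hymono : StrictMonoOn y (Ioo 0 1) :=
    (monotoneOn_quantile ν).strictMonoOn_of_injOn fun σ hσ τ hτ hst => by
      rw [← cdf_quantile ν hσ, ← cdf_quantile ν hτ]; exact congrArg _ hst
  have hzmono : StrictMonoOn z s := fun σ hσ τ hτ hst => by
    refine Real.sqrt_lt_sqrt (mul_pos (hposx σ hσ) (hposy σ hσ)).le ?_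
    exact mul_lt_mul'' (hxmono (hsub hσ) (hsub hτ) hst) (hymono (hsub hσ) (hsub hτ) hst)
      (hposx σ hσ).le (hposy σ hσ).le
  let z' : ℝ → ℝ := fun τ => (deriv x τ * y τ + x τ * deriv y τ) / (2 * z τ)
  have hzderiv : ∀ τ ∈ s, HasDerivAt z (z' τ) τ := fun τ hτ =>
    ((hs τ hτ).1.1.mul (hs τ hτ).2.1).sqrt (mul_pos (hposx τ hτ) (hposy τ hτ)).ne'
  have hkey : ∀ τ ∈ s, 1 ≤ ENNReal.ofReal |z' τ| * k (z τ) := fun τ hτ => by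
    obtain ⟨⟨-, hx0, hx1⟩, -, hy0, hy1⟩ := hs τ hτ
    have hxp := hposx τ hτ
    have hyp := hposy τ hτ
    have hzp : 0 < z τ := Real.sqrt_pos.2 (mul_pos hxp hyp)
    have hz2 : z τ ^ 2 = x τ * y τ := Real.sq_sqrt (mul_pos hxp hyp).le
    have hamgm : deriv x τ * deriv y τ ≤ |z' τ| ^ 2 := by
      rw [sq_abs, div_pow, le_div_iff₀ (by positivity), mul_pow, hz2]
      nlinarith [sq_nonneg (deriv x τ * y τ - x τ * deriv y τ)]
    have hsq : 1 ≤ (ENNReal.ofReal |z' τ| * k (z τ)) ^ 2 := by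
      calc (1 : ENNReal) = (ENNReal.ofReal (deriv x τ) * g₁ (x τ)) *
            (ENNReal.ofReal (deriv y τ) * g₂ (y τ)) := by rw [hx1, hy1, one_mul]
        _ = ENNReal.ofReal (deriv x τ * deriv y τ) * (g₁ (x τ) * g₂ (y τ)) := by
            rw [ENNReal.ofReal_mul hx0.le]; ring
        _ ≤ ENNReal.ofReal (|z' τ| ^ 2) * k (z τ) ^ 2 := by
            gcongr
            exact h _ _ hxp hyp
        _ = _ := by rw [mul_pow, ENNReal.ofReal_pow (abs_nonneg _)]
    by_contra hlt
    exact absurd hsq (not_le.2 (pow_lt_one₀ zero_le (not_le.1 hlt) two_ne_zero))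
  refine Measure.le_iff.2 fun u hu => ?_
  rw [Measure.map_apply_of_aemeasurable hzm hu, withDensity_apply _ hu, hres,
    Measure.restrict_restrict hu]
  have hzc : ContinuousOn z s := fun τ hτ => (hzderiv τ hτ).continuousAt.continuousWithinAt
  have hms : MeasurableSet (s ∩ z ⁻¹' u) := by
    have := hsm.subtype_image ((continuousOn_iff_continuous_domRestrict.1 hzc).measurable hu)
    rwa [show Subtype.val '' (s.domRestrict z ⁻¹' u) = s ∩ z ⁻¹' u by
      ext τ; simp [and_comm]] at this
  rw [Measure.restrict_apply' hsm, inter_comm]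
  calc volume (s ∩ z ⁻¹' u) = ∫⁻ _ in s ∩ z ⁻¹' u, 1 := by simp
    _ ≤ ∫⁻ τ in s ∩ z ⁻¹' u, ENNReal.ofReal |z' τ| * k (z τ) :=
        setLIntegral_mono' hms fun τ hτ => hkey τ hτ.1
    _ = ∫⁻ r in z '' (s ∩ z ⁻¹' u), k r :=
        (lintegral_image_eq_lintegral_abs_deriv_mul hms
          (fun τ hτ => (hzderiv τ hτ.1).hasDerivWithinAt) (hzmono.injOn.mono inter_subset_left)
          k).symm
    _ ≤ ∫⁻ r in u ∩ Ioi 0, k r := by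
        refine lintegral_mono_set ?_
        rintro _ ⟨τ, hτ, rfl⟩
        exact ⟨hτ.2, Real.sqrt_pos.2 (mul_pos (hposx τ hτ.1) (hposy τ hτ.1))⟩

/-- The Prékopa–Leindler inequality on the half-line with multiplicative means. In the case of
equality the law of the geometric mean of the monotone coupling has density proportional to `χ`, and
the Cauchy–Schwarz inequality then compares the moments of order `-2`. -/
lemma integral_mul_integral_le_sq_integral_sqrt {φ ψ χ : ℝ → ℝ} (hφm : Measurable φ)
    (hψm : Measurable ψ) (hχm : Measurable χ) (hφ : ∀ t, 0 ≤ φ t) (hψ : ∀ t, 0 ≤ ψ t)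
    (hχ : ∀ t, 0 ≤ χ t) (hφi : IntegrableOn φ (Ioi 0)) (hψi : IntegrableOn ψ (Ioi 0))
    (hχi : IntegrableOn χ (Ioi 0))
    (h : ∀ a b, 0 < a → 0 < b → φ a * ψ b ≤ χ (√(a * b)) ^ 2) :
    (∫ t in Ioi 0, φ t) * (∫ t in Ioi 0, ψ t) ≤ (∫ t in Ioi 0, χ t) ^ 2 ∧
    (0 < ∫ t in Ioi 0, χ t →
      (∫ t in Ioi 0, φ t) * (∫ t in Ioi 0, ψ t) = (∫ t in Ioi 0, χ t) ^ 2 →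
      (∫⁻ t in Ioi 0, ENNReal.ofReal (χ t / t ^ 2)) ^ 2 ≤
        (∫⁻ t in Ioi 0, ENNReal.ofReal (φ t / t ^ 2)) *
          (∫⁻ t in Ioi 0, ENNReal.ofReal (ψ t / t ^ 2))) := by
  set I := ∫ t in Ioi 0, φ t with hI
  set J := ∫ t in Ioi 0, ψ t with hJ
  set X := ∫ t in Ioi 0, χ t with hX
  have hI0 : 0 ≤ I := integral_nonneg hφ
  have hJ0 : 0 ≤ J := integral_nonneg hψ
  have hX0 : 0 ≤ X := integral_nonneg hχ
  rcases hI0.eq_or_lt with hI1 | hIpos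
  · rw [← hI1, zero_mul]
    exact ⟨sq_nonneg _, fun hp he => absurd he (pow_pos hp 2).ne⟩
  rcases hJ0.eq_or_lt with hJ1 | hJpos
  · rw [← hJ1, mul_zero]
    exact ⟨sq_nonneg _, fun hp he => absurd he (pow_pos hp 2).ne⟩
  have hIJ : 0 < √(I * J) := Real.sqrt_pos.2 (mul_pos hIpos hJpos)
  have hIJ2 : √(I * J) ^ 2 = I * J := Real.sq_sqrt (mul_pos hIpos hJpos).le
  -- the normalized densities
  have key : ∀ (f : ℝ → ℝ) (c : ℝ), Measurable f → (∀ t, 0 ≤ f t) → IntegrableOn f (Ioi 0) →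
      0 < c → c = ∫ t in Ioi 0, f t →
      IsProbabilityMeasure (volume.withDensity
        ((Ioi 0).indicator fun t => ENNReal.ofReal (f t / c))) := by
    intro f c hfm hf hfi hc hfc
    refine ⟨?_⟩
    rw [withDensity_apply _ MeasurableSet.univ, Measure.restrict_univ,
      lintegral_indicator measurableSet_Ioi, ← ofReal_integral_eq_lintegral_ofReal
        (hfi.div_const c) (ae_of_all _ fun t => div_nonneg (hf t) hc.le), integral_div, ← hfc,
      div_self hc.ne', ENNReal.ofReal_one]
  set g₁ : ℝ → ENNReal := (Ioi 0).indicator fun t => ENNReal.ofReal (φ t / I) with hg₁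
  set g₂ : ℝ → ENNReal := (Ioi 0).indicator fun t => ENNReal.ofReal (ψ t / J) with hg₂
  set k : ℝ → ENNReal := fun t => ENNReal.ofReal (χ t / √(I * J)) with hk
  have hg₁m : Measurable g₁ := (hφm.div_const I).ennreal_ofReal.indicator measurableSet_Ioi
  have hg₂m : Measurable g₂ := (hψm.div_const J).ennreal_ofReal.indicator measurableSet_Ioi
  have hkm : Measurable k := (hχm.div_const _).ennreal_ofReal
  have hp₁ := key φ I hφm hφ hφi hIpos rfl
  have hp₂ := key ψ J hψm hψ hψi hJpos rfl
  set μ := volume.withDensity g₁ with hμ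
  set ν := volume.withDensity g₂ with hν
  have hle := map_sqrt_quantile_mul_le μ ν (k := k) hg₁m hg₂m hμ hν
    (fun a ha => indicator_of_notMem (notMem_Ioi.2 ha) _)
    (fun a ha => indicator_of_notMem (notMem_Ioi.2 ha) _) (fun a b ha hb => by
      simp only [hg₁, hg₂, hk, indicator_of_mem (mem_Ioi.2 ha), indicator_of_mem (mem_Ioi.2 hb)]
      rw [← ENNReal.ofReal_mul (div_nonneg (hφ a) hI0),
        ← ENNReal.ofReal_pow (div_nonneg (hχ _) hIJ.le), div_pow, hIJ2, div_mul_div_comm]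
      exact ENNReal.ofReal_le_ofReal (div_le_div_of_nonneg_right (h a b ha hb)
        (mul_pos hIpos hJpos).le))
  set z : ℝ → ℝ := fun τ => √(quantile μ τ * quantile ν τ) with hz
  have hzm : AEMeasurable z (volume.restrict (Ioo 0 1)) :=
    ((aemeasurable_quantile μ).mul (aemeasurable_quantile ν)).sqrt
  have hmass : (volume.restrict (Ioo 0 1)).map z univ = 1 := by
    rw [Measure.map_apply_of_aemeasurable hzm MeasurableSet.univ]; simp
  have hmass' : (volume.restrict (Ioi 0)).withDensity k univ = ENNReal.ofReal (X / √(I * J)) := by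
    rw [withDensity_apply _ MeasurableSet.univ, Measure.restrict_univ, hX, ← integral_div,
      ofReal_integral_eq_lintegral_ofReal (hχi.div_const _)
        (ae_of_all _ fun t => div_nonneg (hχ t) hIJ.le)]
  have hIJX : √(I * J) ≤ X := by
    have h1 := hle univ
    rw [hmass, hmass', ENNReal.one_le_ofReal, one_le_div hIJ] at h1
    exact h1
  refine ⟨by rw [← hIJ2]; exact pow_le_pow_left₀ hIJ.le hIJX 2, fun hXpos heq => ?_⟩
  have hXeq : √(I * J) = X := by rw [heq, Real.sqrt_sq hX0]
  have : IsFiniteMeasure ((volume.restrict (Ioi 0)).withDensity k) :=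
    ⟨by rw [hmass']; exact ENNReal.ofReal_lt_top⟩
  have hmeq : (volume.restrict (Ioo 0 1)).map z = (volume.restrict (Ioi 0)).withDensity k := by
    refine Measure.eq_of_le_of_measure_univ_eq hle ?_
    rw [hmass, hmass', hXeq, div_self hXpos.ne', ENNReal.ofReal_one]
  have hinv : Measurable fun t : ℝ => ENNReal.ofReal (1 / t ^ 2) := by fun_prop
  -- moments of order `-2` expressed through the coupling
  have hmom : ∀ (f : ℝ → ℝ) (c : ℝ), Measurable f → 0 < c → (∀ t, 0 ≤ f t) →
      ∫⁻ t in Ioi 0, ENNReal.ofReal (f t / t ^ 2) =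
        ENNReal.ofReal c * ∫⁻ t in Ioi 0, ENNReal.ofReal (f t / c) * ENNReal.ofReal (1 / t ^ 2) := by
    intro f c hfm hc hf
    rw [← lintegral_const_mul _ (by fun_prop)]
    refine lintegral_congr fun t => ?_
    rw [← ENNReal.ofReal_mul (div_nonneg (hf t) hc.le), ← ENNReal.ofReal_mul hc.le]
    congr 1
    field_simp
  have hquant : ∀ (f : ℝ → ℝ) (c : ℝ) (ρ : Measure ℝ), IsProbabilityMeasure ρ → Measurable f →
      ρ = volume.withDensity ((Ioi 0).indicator fun t => ENNReal.ofReal (f t / c)) →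
      ∫⁻ t in Ioi 0, ENNReal.ofReal (f t / c) * ENNReal.ofReal (1 / t ^ 2) =
        ∫⁻ τ in Ioo 0 1, ENNReal.ofReal (1 / quantile ρ τ ^ 2) := by
    intro f c ρ _ hfm hρ
    rw [← lintegral_map' hinv.aemeasurable (aemeasurable_quantile ρ), map_quantile]
    conv_rhs => rw [hρ]
    rw [lintegral_withDensity_eq_lintegral_mul _
      (((hfm.div_const c).ennreal_ofReal).indicator measurableSet_Ioi) hinv,
      ← lintegral_indicator measurableSet_Ioi]
    refine lintegral_congr fun t => ?_
    by_cases ht : t ∈ Ioi (0 : ℝ) <;> simp [ht]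
  have hpos : ∀ (f : ℝ → ℝ) (c : ℝ) (ρ : Measure ℝ), IsProbabilityMeasure ρ →
      ρ = volume.withDensity ((Ioi 0).indicator fun t => ENNReal.ofReal (f t / c)) →
      ∀ᵐ τ ∂(volume.restrict (Ioo (0 : ℝ) 1)), 0 < quantile ρ τ := by
    intro f c ρ _ hρ
    refine ae_of_ae_map (p := fun a => 0 < a) (aemeasurable_quantile ρ) ?_
    have hset : MeasurableSet {a : ℝ | ¬ 0 < a} := measurableSet_Ioi.compl
    rw [map_quantile, ae_iff, hρ, withDensity_apply _ hset,
      setLIntegral_indicator measurableSet_Ioi]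
    rw [show Ioi 0 ∩ {a : ℝ | ¬ 0 < a} = ∅ by ext; simp]
    simp
  have hzmom : ∫⁻ t in Ioi 0, ENNReal.ofReal (χ t / √(I * J)) * ENNReal.ofReal (1 / t ^ 2) =
      ∫⁻ τ in Ioo 0 1, ENNReal.ofReal (1 / quantile μ τ) * ENNReal.ofReal (1 / quantile ν τ) := by
    calc _ = ∫⁻ t, ENNReal.ofReal (1 / t ^ 2) ∂((volume.restrict (Ioi 0)).withDensity k) := by
          rw [lintegral_withDensity_eq_lintegral_mul _ hkm hinv]; rfl
      _ = ∫⁻ τ in Ioo 0 1, ENNReal.ofReal (1 / z τ ^ 2) := by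
          rw [← hmeq, lintegral_map' hinv.aemeasurable hzm]
      _ = _ := by
          refine lintegral_congr_ae ?_
          filter_upwards [hpos φ I μ hp₁ hμ, hpos ψ J ν hp₂ hν] with τ h1 h2
          rw [hz, ← ENNReal.ofReal_mul (by positivity), Real.sq_sqrt (mul_pos h1 h2).le,
            one_div_mul_one_div]
  have hCS := ENNReal.lintegral_mul_le_Lp_mul_Lq (volume.restrict (Ioo (0 : ℝ) 1))
    Real.HolderConjugate.two_two
    (f := fun τ => ENNReal.ofReal (1 / quantile μ τ)) (g := fun τ => ENNReal.ofReal (1 / quantile ν τ))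
    (((aemeasurable_quantile μ).const_div 1).ennreal_ofReal)
    (((aemeasurable_quantile ν).const_div 1).ennreal_ofReal)
  have hsq : ∀ (ρ : Measure ℝ) (f : ℝ → ℝ) (c : ℝ), IsProbabilityMeasure ρ →
      ρ = volume.withDensity ((Ioi 0).indicator fun t => ENNReal.ofReal (f t / c)) →
      ∫⁻ τ in Ioo 0 1, ENNReal.ofReal (1 / quantile ρ τ) ^ (2 : ℝ) =
        ∫⁻ τ in Ioo 0 1, ENNReal.ofReal (1 / quantile ρ τ ^ 2) := by
    intro ρ f c hρp hρ
    refine lintegral_congr_ae ?_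
    filter_upwards [hpos f c ρ hρp hρ] with τ h1
    rw [ENNReal.rpow_two, ← ENNReal.ofReal_pow (by positivity), div_pow, one_pow]
  simp only [Pi.mul_apply] at hCS
  rw [hsq μ φ I hp₁ hμ, hsq ν ψ J hp₂ hν, ← hzmom] at hCS
  rw [hmom χ √(I * J) hχm hIJ hχ, hmom φ I hφm hIpos hφ, hmom ψ J hψm hJpos hψ,
    hquant φ I μ hp₁ hφm hμ, hquant ψ J ν hp₂ hψm hν, mul_pow, ← ENNReal.ofReal_pow hIJ.le, hIJ2,
    mul_mul_mul_comm, ← ENNReal.ofReal_mul hI0]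
  gcongr
  calc _ ≤ _ := pow_le_pow_left' hCS 2
    _ = _ := by
      rw [mul_pow, ← ENNReal.rpow_two, ← ENNReal.rpow_two, ← ENNReal.rpow_mul, ← ENNReal.rpow_mul]
      norm_num

/-! ### Bounded functions with bounded support, and shears -/

/-- The class of functions the induction runs over: measurable, nonnegative, bounded, and with
bounded support. Products with continuous functions are integrable. -/
structure IsNice {X : Type*} [NormedAddCommGroup X] [MeasurableSpace X] (f : X → ℝ) : Prop where
  measurable : Measurable f
  nonneg : ∀ x, 0 ≤ f x
  bounded : ∃ M, ∀ x, f x ≤ M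
  support : Bornology.IsBounded (Function.support f)

namespace IsNice

variable {X Y F : Type*} [NormedAddCommGroup X] [MeasurableSpace X] [BorelSpace X]
  [NormedAddCommGroup Y] [MeasurableSpace Y] [BorelSpace Y]
  [NormedAddCommGroup F] [NormedSpace ℝ F]

lemma integrable_smul [ProperSpace X] {f : X → ℝ} (hf : IsNice f)
    (μ : Measure X) [IsFiniteMeasureOnCompacts μ] {w : X → F} (hw : Continuous w) :
    Integrable (fun x => f x • w x) μ := by
  obtain ⟨M, hM⟩ := hf.bounded
  obtain ⟨R, hR⟩ := hf.support.subset_closedBall 0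
  have hc : IsCompact (Metric.closedBall (0 : X) R) := isCompact_closedBall _ _
  have h1 : IntegrableOn w (Metric.closedBall (0 : X) R) μ := hw.continuousOn.integrableOn_compact hc
  have h2 : IntegrableOn (fun x => f x • w x) (Metric.closedBall (0 : X) R) μ :=
    h1.bdd_smul M hf.measurable.aestronglyMeasurable (ae_of_all _ fun x => by
      rw [Real.norm_of_nonneg (hf.nonneg x)]; exact hM x)
  refine (integrableOn_iff_integrable_of_support_subset ?_).1 h2
  intro x hx
  exact hR (fun h0 => hx (by simp [h0]))

lemma integrable_mul [ProperSpace X] {f : X → ℝ} (hf : IsNice f)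
    (μ : Measure X) [IsFiniteMeasureOnCompacts μ] {w : X → ℝ} (hw : Continuous w) :
    Integrable (fun x => w x * f x) μ := by
  simpa [mul_comm] using hf.integrable_smul μ hw

lemma integrable [ProperSpace X] {f : X → ℝ} (hf : IsNice f)
    (μ : Measure X) [IsFiniteMeasureOnCompacts μ] : Integrable f μ := by
  simpa using hf.integrable_mul μ (w := fun _ => 1) continuous_const

omit [BorelSpace X] in
lemma mul_indicator {f : X → ℝ} (hf : IsNice f) {s : Set X} (hs : MeasurableSet s) :
    IsNice (s.indicator f) where
  measurable := hf.measurable.indicator hs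
  nonneg := fun x => indicator_nonneg (fun x _ => hf.nonneg x) x
  bounded := by
    obtain ⟨M, hM⟩ := hf.bounded
    exact ⟨M, fun x => (indicator_le_self' (fun x _ => hf.nonneg x) x).trans (hM x)⟩
  support := hf.support.subset (by rw [support_indicator]; exact inter_subset_right)

lemma comp_homeomorph [ProperSpace Y] {f : Y → ℝ} (hf : IsNice f) (e : X ≃ₜ Y) :
    IsNice (fun x => f (e x)) where
  measurable := hf.measurable.comp e.continuous.measurable
  nonneg := fun x => hf.nonneg _
  bounded := by
    obtain ⟨M, hM⟩ := hf.bounded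
    exact ⟨M, fun x => hM _⟩
  support := by
    obtain ⟨R, hR⟩ := hf.support.subset_closedBall 0
    refine (((isCompact_closedBall (0 : Y) R).image e.symm.continuous).isBounded).subset ?_
    intro x hx
    exact ⟨e x, hR hx, e.symm_apply_apply x⟩

omit [BorelSpace X] in
/-- The partial integral of a function over the positive half of the last coordinate. -/
lemma integral_Ioi {f : X × ℝ → ℝ} (hf : IsNice f) :
    IsNice (fun x => ∫ a in Ioi 0, f (x, a)) where
  measurable := (hf.measurable.stronglyMeasurable.integral_prod_right'
    (ν := volume.restrict (Ioi (0 : ℝ)))).measurable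
  nonneg := fun x => integral_nonneg fun a => hf.nonneg _
  bounded := by
    obtain ⟨M, hM⟩ := hf.bounded
    obtain ⟨R, hR⟩ := hf.support.subset_closedBall 0
    refine ⟨∫ a in Ioi 0, (Icc (-R) R).indicator (fun _ => M) a, fun x => ?_⟩
    refine integral_mono_of_nonneg (ae_of_all _ fun a => hf.nonneg _) ?_ (ae_of_all _ fun a => ?_)
    · refine Integrable.integrableOn ?_
      rw [integrable_indicator_iff measurableSet_Icc]
      exact integrableOn_const (by simp)
    · by_cases ha : a ∈ Icc (-R) R
      · simpa [ha] using hM (x, a)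
      · have : f (x, a) = 0 := by
          by_contra h0
          have h1 := hR h0
          rw [mem_closedBall_zero_iff] at h1
          exact ha (abs_le.1 ((norm_snd_le (x, a)).trans h1))
        simp [ha, this]
  support := by
    obtain ⟨R, hR⟩ := hf.support.subset_closedBall 0
    refine (Metric.isBounded_closedBall (x := (0 : X)) (r := R)).subset fun x hx => ?_
    by_contra h0
    refine hx ?_
    have : ∀ a, f (x, a) = 0 := fun a => by
      by_contra h1
      have h2 := hR h1
      rw [mem_closedBall_zero_iff] at h2 h0
      exact h0 ((norm_fst_le (x, a)).trans h2)
    simp [this]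

lemma integral_integral_Ioi_smul [ProperSpace X] [CompleteSpace F] [SecondCountableTopology X]
    (μ : Measure X) [SFinite μ] [IsFiniteMeasureOnCompacts μ]
    {f : X × ℝ → ℝ} (hf : IsNice f) {w : X → F} (hw : Continuous w) :
    ∫ x, (∫ a in Ioi 0, f (x, a)) • w x ∂μ =
      ∫ q in {q : X × ℝ | 0 < q.2}, f q • w q.1 ∂(μ.prod volume) := by
  have hs : {q : X × ℝ | 0 < q.2} = univ ×ˢ Ioi 0 := by ext; simp
  have hi : Integrable (fun q : X × ℝ => f q • w q.1) (μ.prod volume) :=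
    hf.integrable_smul _ (hw.comp continuous_fst)
  rw [hs, setIntegral_prod _ hi.integrableOn, Measure.restrict_univ]
  refine integral_congr_ae (ae_of_all _ fun x => ?_)
  simp only
  rw [integral_smul_const]

end IsNice

section Shear

variable {X Y : Type*} [TopologicalSpace X] [TopologicalSpace Y] [AddGroup Y]
  [IsTopologicalAddGroup Y]

/-- The shear `(x, y) ↦ (x, y + g x)`. -/
def shearSnd (g : X → Y) (hg : Continuous g) : X × Y ≃ₜ X × Y where
  toFun p := (p.1, p.2 + g p.1)
  invFun p := (p.1, p.2 - g p.1)
  left_inv p := by simp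
  right_inv p := by simp
  continuous_toFun := by fun_prop
  continuous_invFun := by fun_prop

/-- The shear `(y, x) ↦ (y + g x, x)`. -/
def shearFst (g : X → Y) (hg : Continuous g) : Y × X ≃ₜ Y × X where
  toFun p := (p.1 + g p.2, p.2)
  invFun p := (p.1 - g p.2, p.2)
  left_inv p := by simp
  right_inv p := by simp
  continuous_toFun := by fun_prop
  continuous_invFun := by fun_prop

variable [MeasurableSpace X] [BorelSpace X] [MeasurableSpace Y] [BorelSpace Y]
  [SecondCountableTopology X] [SecondCountableTopology Y]

omit [SecondCountableTopology X] in
lemma measurePreserving_shearSnd (μ : Measure X) (ν : Measure Y) [SFinite μ] [SFinite ν]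
    [ν.IsAddRightInvariant] (g : X → Y) (hg : Continuous g) :
    MeasurePreserving (shearSnd g hg) (μ.prod ν) (μ.prod ν) := by
  refine (MeasurePreserving.id μ).skew_product (g := fun x y => y + g x) (by fun_prop)
    (ae_of_all _ fun x => map_add_right_eq_self ν (g x))

omit [SecondCountableTopology X] in
lemma measurePreserving_shearFst (μ : Measure X) (ν : Measure Y) [SFinite μ] [SFinite ν]
    [ν.IsAddRightInvariant] (g : X → Y) (hg : Continuous g) :
    MeasurePreserving (shearFst g hg) (ν.prod μ) (ν.prod μ) :=
  (Measure.measurePreserving_swap.comp (measurePreserving_shearSnd μ ν g hg)).comp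
    Measure.measurePreserving_swap

end Shear

/-! ### The functional inequality and its one-dimensional case -/

section Defs

variable {V : Type*} [NormedAddCommGroup V] [NormedSpace ℝ V] [MeasureSpace V]

/-- The second moment `∫_{t > 0} t² θ(t² + ⟨x, x⟩)` of a radial function on a half-space of
`ℝ × V`, where `dot` plays the role of the inner product of `V`. -/
noncomputable def radialMoment (dot : V → V → ℝ) (θ : ℝ → ℝ) : ℝ :=
  ∫ v in {v : ℝ × V | 0 < v.1}, v.1 ^ 2 * θ (v.1 ^ 2 + dot v.2 v.2)

/-- The mass `∫_{t > 0} θ(t² + ⟨x, x⟩)` of a radial function on a half-space of `ℝ × V`. -/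
noncomputable def radialMass (dot : V → V → ℝ) (θ : ℝ → ℝ) : ℝ :=
  ∫ v in {v : ℝ × V | 0 < v.1}, θ (v.1 ^ 2 + dot v.2 v.2)

/-- Functional duality on the half-space `t > 0` of `ℝ × V`: `A(v) B(w) ≤ θ(⟨v, w⟩)²` wherever the
pairing is positive. For the indicators of the halves `t > 0` of a convex body and of its polar body,
`θ` is the indicator of `(0, 1]`. -/
def IsDualPair (dot : V → V → ℝ) (θ : ℝ → ℝ) (A B : ℝ × V → ℝ) : Prop :=
  ∀ v w : ℝ × V, 0 < v.1 → 0 < w.1 → 0 < v.1 * w.1 + dot v.2 w.2 →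
    A v * B w ≤ θ (v.1 * w.1 + dot v.2 w.2) ^ 2

/-- The conclusion of the functional inequality for the numbers `a₂`, `a₀` (second moment and mass
of the first function), `b₂`, `b₀` (same for the second one) and `J`, `I` (same for the radial
function): the product of the second moments is at most `J²`, and if it is equal to `J²`, then the
product of the masses is at least `I²`. -/
def SantaloBound (a₂ a₀ b₂ b₀ J I : ℝ) : Prop :=
  a₂ * b₂ ≤ J ^ 2 ∧ (0 < J → a₂ * b₂ = J ^ 2 → I ^ 2 ≤ a₀ * b₀)

/-- The functional Blaschke–Santaló inequality for second moments in `ℝ × V`: it holds for dual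
pairs whose first member has vanishing mixed moments `∫ t x A(t, x)`. -/
def SantaloInequality (V : Type*) [NormedAddCommGroup V] [NormedSpace ℝ V] [MeasureSpace V]
    (dot : V → V → ℝ) : Prop :=
  ∀ (θ : ℝ → ℝ) (A B : ℝ × V → ℝ), IsNice θ → IsNice A → IsNice B →
    (∀ v, v.1 ≤ 0 → A v = 0) → (∀ v, v.1 ≤ 0 → B v = 0) → IsDualPair dot θ A B →
    ∫ v, A v • v.1 • v.2 = 0 →
    SantaloBound (∫ v, v.1 ^ 2 * A v) (∫ v, A v) (∫ v, v.1 ^ 2 * B v) (∫ v, B v)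
      (radialMoment dot θ) (radialMass dot θ)

end Defs

lemma IsNice.comp_sq {X : Type*} [NormedAddCommGroup X] [MeasurableSpace X] [BorelSpace X]
    {θ : ℝ → ℝ} (hθ : IsNice θ) {q : X → ℝ} (hq : Continuous q)
    (hcoer : ∀ R, Bornology.IsBounded {x | q x ≤ R}) : IsNice fun x => θ (q x) where
  measurable := hθ.measurable.comp hq.measurable
  nonneg := fun x => hθ.nonneg _
  bounded := by
    obtain ⟨M, hM⟩ := hθ.bounded
    exact ⟨M, fun x => hM _⟩
  support := by
    obtain ⟨R, hR⟩ := hθ.support.subset_closedBall 0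
    refine (hcoer R).subset fun x hx => ?_
    have := hR hx
    rw [mem_closedBall_zero_iff] at this
    exact (le_abs_self _).trans this

/-- The inequality in dimension one: the half-line Prékopa–Leindler inequality for the densities
`t² A`, `t² B` and `t² θ(t²)`, whose moments of order `-2` are the masses of `A`, `B` and
`θ(t²)`. -/
lemma santaloBound_halfline {θ A B : ℝ → ℝ} (hθ : IsNice θ) (hA : IsNice A) (hB : IsNice B)
    (h : ∀ a b, 0 < a → 0 < b → A a * B b ≤ θ (a * b) ^ 2) :
    SantaloBound (∫ t in Ioi 0, t ^ 2 * A t) (∫ t in Ioi 0, A t) (∫ t in Ioi 0, t ^ 2 * B t)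
      (∫ t in Ioi 0, B t) (∫ t in Ioi 0, t ^ 2 * θ (t ^ 2)) (∫ t in Ioi 0, θ (t ^ 2)) := by
  have hθ' : IsNice fun t : ℝ => θ (t ^ 2) := hθ.comp_sq (by fun_prop) fun R => by
    refine (Metric.isBounded_closedBall (x := (0 : ℝ)) (r := R + 1)).subset fun x hx => ?_
    rw [mem_closedBall_zero_iff, Real.norm_eq_abs, abs_le]
    have : x ^ 2 ≤ R := hx
    constructor <;> nlinarith [sq_nonneg (x - 1), sq_nonneg (x + 1)]
  have hc : Continuous fun t : ℝ => t ^ 2 := by fun_prop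
  have hint : ∀ {f : ℝ → ℝ}, IsNice f → IntegrableOn (fun t => t ^ 2 * f t) (Ioi 0) :=
    fun hf => (hf.integrable_mul volume hc).integrableOn
  have hm : ∀ {f : ℝ → ℝ}, IsNice f → ∫⁻ t in Ioi 0, ENNReal.ofReal (t ^ 2 * f t / t ^ 2) =
      ENNReal.ofReal (∫ t in Ioi 0, f t) := fun hf => by
    rw [ofReal_integral_eq_lintegral_ofReal (hf.integrable volume).integrableOn
      (ae_of_all _ hf.nonneg)]
    refine setLIntegral_congr_fun measurableSet_Ioi fun t ht => ?_
    have : t ≠ 0 := (mem_Ioi.1 ht).ne'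
    congr 1
    field_simp
  obtain ⟨h1, h2⟩ := integral_mul_integral_le_sq_integral_sqrt
    (φ := fun t => t ^ 2 * A t) (ψ := fun t => t ^ 2 * B t) (χ := fun t => t ^ 2 * θ (t ^ 2))
    (hc.measurable.mul hA.measurable) (hc.measurable.mul hB.measurable)
    (hc.measurable.mul hθ'.measurable) (fun t => mul_nonneg (sq_nonneg t) (hA.nonneg t))
    (fun t => mul_nonneg (sq_nonneg t) (hB.nonneg t))
    (fun t => mul_nonneg (sq_nonneg t) (hθ.nonneg _)) (hint hA) (hint hB) (hint hθ')
    (fun a b ha hb => by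
      rw [Real.sq_sqrt (mul_pos ha hb).le]
      calc a ^ 2 * A a * (b ^ 2 * B b) = (a * b) ^ 2 * (A a * B b) := by ring
        _ ≤ (a * b) ^ 2 * θ (a * b) ^ 2 := by gcongr; exact h a b ha hb
        _ = _ := by ring)
  refine ⟨h1, fun hpos heq => ?_⟩
  have h3 := h2 hpos heq
  rw [hm hA, hm hB, hm hθ', ← ENNReal.ofReal_pow (integral_nonneg hθ'.nonneg),
    ← ENNReal.ofReal_mul (integral_nonneg hA.nonneg)] at h3
  exact (ENNReal.ofReal_le_ofReal_iff (mul_nonneg (integral_nonneg hA.nonneg)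
    (integral_nonneg hB.nonneg))).1 h3

lemma volume_eq_dirac_of_subsingleton (V : Type*) [NormedAddCommGroup V] [InnerProductSpace ℝ V]
    [FiniteDimensional ℝ V] [MeasurableSpace V] [BorelSpace V] [Subsingleton V] :
    (volume : Measure V) = Measure.dirac 0 := by
  ext s hs
  rcases s.eq_empty_or_nonempty with rfl | ⟨x, hx⟩
  · simp
  · have hs : s = univ := Set.eq_univ_of_forall fun y => Subsingleton.elim x y ▸ hx
    have hb := (stdOrthonormalBasis ℝ V).volume_parallelepiped
    have : parallelepiped (stdOrthonormalBasis ℝ V) = univ :=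
      Set.eq_univ_of_forall fun y => by
        rw [mem_parallelepiped_iff]
        exact ⟨0, by simp, Subsingleton.elim _ _⟩
    rw [hs, ← this, hb, this]; simp

/-- The inequality on `ℝ × V` with `V` trivial. -/
lemma santaloInequality_of_subsingleton (V : Type*) [NormedAddCommGroup V] [InnerProductSpace ℝ V]
    [FiniteDimensional ℝ V] [MeasurableSpace V] [BorelSpace V] [Subsingleton V] :
    SantaloInequality V (fun x y => inner ℝ x y) := by
  intro θ A B hθ hA hB hA0 hB0 hpair _
  have hvol : (volume : Measure (ℝ × V)) = volume.map fun t => (t, 0) := by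
    rw [Measure.volume_eq_prod, volume_eq_dirac_of_subsingleton V, Measure.prod_dirac]
  have hemb : MeasurableEmbedding fun t : ℝ => (t, (0 : V)) := by
    refine (Topology.IsClosedEmbedding.of_continuous_injective_isClosedMap (by fun_prop)
      (fun a b h => congrArg Prod.fst h) fun s hs => ?_).measurableEmbedding
    have : (fun t : ℝ => (t, (0 : V))) '' s = Prod.fst ⁻¹' s := by
      ext ⟨t, x⟩
      simp [Subsingleton.elim x 0]
    rw [this]
    exact hs.preimage continuous_fst
  have hint : ∀ f : ℝ × V → ℝ, ∫ v, f v = ∫ t, f (t, 0) := fun f => by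
    rw [hvol, hemb.integral_map]
  have hintA : ∀ f : ℝ × V → ℝ, (∀ v, v.1 ≤ 0 → f v = 0) → ∫ v, f v = ∫ t in Ioi 0, f (t, 0) :=
    fun f hf => by
      rw [hint, setIntegral_eq_integral_of_forall_compl_eq_zero]
      exact fun t ht => hf _ (not_lt.1 ht)
  have hset : ∀ f : ℝ × V → ℝ, ∫ v in {v : ℝ × V | 0 < v.1}, f v = ∫ t in Ioi 0, f (t, 0) :=
    fun f => by
      rw [hvol, hemb.setIntegral_map]; rfl
  have hn : ∀ {f : ℝ × V → ℝ}, IsNice f → IsNice fun t => f (t, 0) := fun {f} hf =>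
    { measurable := hf.measurable.comp (by fun_prop)
      nonneg := fun t => hf.nonneg _
      bounded := hf.bounded.imp fun M hM t => hM _
      support := (hf.support.image_fst).subset fun t ht => ⟨(t, 0), ht, rfl⟩ }
  have := santaloBound_halfline hθ (hn hA) (hn hB) fun a b ha hb => by
    simpa using hpair (a, 0) (b, 0) ha hb (by simpa using mul_pos ha hb)
  rw [hintA (fun v => v.1 ^ 2 * A v) (fun v hv => by rw [hA0 v hv, mul_zero]),
    hintA (fun v => v.1 ^ 2 * B v) (fun v hv => by rw [hB0 v hv, mul_zero]),
    hintA A hA0, hintA B hB0, radialMoment, radialMass, hset, hset]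
  simpa using this

/-! ### Integration along lines and the inequality on half-spaces -/

lemma measure_setOf_linearMap_eq_zero {W : Type*} [NormedAddCommGroup W] [NormedSpace ℝ W]
    [FiniteDimensional ℝ W] [MeasurableSpace W] [BorelSpace W] (μ : Measure W)
    [μ.IsAddHaarMeasure] (ℓ : W →L[ℝ] ℝ) (hℓ : ℓ ≠ 0) : μ {v | ℓ v = 0} = 0 := by
  refine Measure.addHaar_submodule μ (LinearMap.ker (ℓ : W →ₗ[ℝ] ℝ)) fun h => hℓ ?_
  ext v
  have : v ∈ LinearMap.ker (ℓ : W →ₗ[ℝ] ℝ) := h ▸ Submodule.mem_top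
  simpa using this

lemma integral_eq_add_of_linearMap {W : Type*} [NormedAddCommGroup W] [NormedSpace ℝ W]
    [FiniteDimensional ℝ W] [MeasurableSpace W] [BorelSpace W] (μ : Measure W)
    [μ.IsAddHaarMeasure] (ℓ : W →L[ℝ] ℝ) (hℓ : ℓ ≠ 0)
    {F : Type*} [NormedAddCommGroup F] [NormedSpace ℝ F] {f : W → F} (hf : Integrable f μ) :
    ∫ v, f v ∂μ = ∫ v in {v | 0 < ℓ v}, f v ∂μ + ∫ v in {v | ℓ v < 0}, f v ∂μ := by
  have hm : MeasurableSet {v | 0 < ℓ v} := measurableSet_lt measurable_const ℓ.continuous.measurable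
  have hm' : MeasurableSet {v | ℓ v < 0} :=
    measurableSet_lt ℓ.continuous.measurable measurable_const
  rw [← integral_add_compl hm hf]
  congr 1
  refine setIntegral_congr_set ?_
  have : {v | 0 < ℓ v}ᶜ = {v | ℓ v < 0} ∪ {v | ℓ v = 0} := by
    ext v; simp [le_iff_lt_or_eq]
  rw [this]
  exact union_ae_eq_left_of_ae_eq_empty 
    (ae_eq_empty.2 (measure_setOf_linearMap_eq_zero μ ℓ hℓ))

section Half

variable {E : Type*} [NormedAddCommGroup E] [InnerProductSpace ℝ E] [FiniteDimensional ℝ E]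
  [MeasurableSpace E] [BorelSpace E]

instance isAddHaarMeasure_volume_prod {X Y : Type*} [NormedAddCommGroup X] [MeasureSpace X]
    [BorelSpace X] [SecondCountableTopology X] [(volume : Measure X).IsAddHaarMeasure]
    [SFinite (volume : Measure X)] [NormedAddCommGroup Y] [MeasureSpace Y]
    [BorelSpace Y] [SecondCountableTopology Y] [(volume : Measure Y).IsAddHaarMeasure]
    [SFinite (volume : Measure Y)] : (volume : Measure (X × Y)).IsAddHaarMeasure :=
  Measure.prod.instIsAddHaarMeasure _ _

/-- The Euclidean inner product of `ℝ × E`. -/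
noncomputable def prodDot (v w : ℝ × E) : ℝ := v.1 * w.1 + inner ℝ v.2 w.2

/-- The rearrangement of coordinates `((t, x), a) ↦ (t, (a, x))`. -/
def fiberHomeomorph (E : Type*) [TopologicalSpace E] : (ℝ × E) × ℝ ≃ₜ ℝ × (ℝ × E) :=
  (Homeomorph.prodAssoc ℝ E ℝ).trans ((Homeomorph.refl ℝ).prodCongr (Homeomorph.prodComm E ℝ))

omit [InnerProductSpace ℝ E] [FiniteDimensional ℝ E] [MeasurableSpace E] [BorelSpace E] in
@[simp] lemma fiberHomeomorph_apply (q : (ℝ × E) × ℝ) :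
    fiberHomeomorph E q = (q.1.1, (q.2, q.1.2)) := rfl

lemma measurePreserving_fiberHomeomorph : MeasurePreserving (fiberHomeomorph E) :=
  ((MeasurePreserving.id volume).prod Measure.measurePreserving_swap).comp
    (measurePreserving_prodAssoc volume volume volume)

/-- The chart `((t, x), a) ↦ (t, (a, x + a β))` of `ℝ × (ℝ × E)` by lines of direction `(1, β)`. -/
def lineChart (β : E) : (ℝ × E) × ℝ ≃ₜ ℝ × (ℝ × E) :=
  (fiberHomeomorph E).trans ((Homeomorph.refl ℝ).prodCongr
    (shearSnd (fun a : ℝ => a • β) (by fun_prop)))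

omit [FiniteDimensional ℝ E] [MeasurableSpace E] [BorelSpace E] in
@[simp] lemma lineChart_apply (β : E) (q : (ℝ × E) × ℝ) :
    lineChart β q = (q.1.1, (q.2, q.1.2 + q.2 • β)) := rfl

lemma measurePreserving_lineChart (β : E) : MeasurePreserving (lineChart β) :=
  ((MeasurePreserving.id volume).prod (measurePreserving_shearSnd volume volume _ _)).comp
    measurePreserving_fiberHomeomorph

/-- The chart `((s, y), b) ↦ (s, (b - ⟨β, y⟩, y))` of `ℝ × (ℝ × E)`, dual to `lineChart β`. -/
noncomputable def dualChart (β : E) : (ℝ × E) × ℝ ≃ₜ ℝ × (ℝ × E) :=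
  (shearSnd (fun p : ℝ × E => -(inner ℝ β p.2 : ℝ)) (by fun_prop)).trans (fiberHomeomorph E)

omit [FiniteDimensional ℝ E] [MeasurableSpace E] [BorelSpace E] in
@[simp] lemma dualChart_apply (β : E) (q : (ℝ × E) × ℝ) :
    dualChart β q = (q.1.1, (q.2 - inner ℝ β q.1.2, q.1.2)) := rfl

lemma measurePreserving_dualChart (β : E) : MeasurePreserving (dualChart β) :=
  measurePreserving_fiberHomeomorph.comp (measurePreserving_shearSnd _ _ _ _)

/-- The kernel `w ↦ ∫_{r > 0} θ(w + r²)` governing the partial integrals of a dual pair. -/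
noncomputable def fiberKernel (θ : ℝ → ℝ) : ℝ → ℝ :=
  (Ioi 0).indicator fun w => ∫ r in Ioi 0, θ (w + r ^ 2)

lemma fiberKernel_apply (θ : ℝ → ℝ) {w : ℝ} (hw : 0 < w) :
    fiberKernel θ w = ∫ r in Ioi 0, θ (w + r ^ 2) := indicator_of_mem (mem_Ioi.2 hw) _

lemma IsNice.fiberKernel {θ : ℝ → ℝ} (hθ : IsNice θ) : IsNice (fiberKernel θ) := by
  have h : IsNice fun q : ℝ × ℝ => (Ioi (0 : ℝ) ×ˢ univ).indicator (fun q => θ (q.1 + q.2 ^ 2)) q :=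
    { measurable := (hθ.measurable.comp (by fun_prop)).indicator
        (measurableSet_Ioi.prod MeasurableSet.univ)
      nonneg := fun q => indicator_nonneg (fun _ _ => hθ.nonneg _) q
      bounded := by
        obtain ⟨M, hM⟩ := hθ.bounded
        exact ⟨M, fun q => (indicator_le_self' (fun _ _ => hθ.nonneg _) q).trans (hM _)⟩
      support := by
        obtain ⟨R, hR⟩ := hθ.support.subset_closedBall 0
        refine (Metric.isBounded_closedBall (x := (0 : ℝ × ℝ)) (r := R + 1)).subset fun q hq => ?_
        rw [support_indicator] at hq
        have h1 : 0 < q.1 := hq.1.1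
        have h2 := hR hq.2
        rw [mem_closedBall_zero_iff, Real.norm_eq_abs, abs_le] at h2
        rw [mem_closedBall_zero_iff, Prod.norm_def, max_le_iff, Real.norm_eq_abs, Real.norm_eq_abs,
          abs_le, abs_le]
        refine ⟨⟨?_, ?_⟩, ?_, ?_⟩ <;> nlinarith [sq_nonneg (q.2 - 1), sq_nonneg (q.2 + 1)] }
  have h2 := h.integral_Ioi
  convert h2 using 1
  funext w
  by_cases hw : w ∈ Ioi (0 : ℝ) <;> simp [_root_.fiberKernel, hw]

omit [FiniteDimensional ℝ E] [MeasurableSpace E] [BorelSpace E] in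
lemma isBounded_sq_add_prodDot_le (R : ℝ) :
    Bornology.IsBounded {v : ℝ × (ℝ × E) | v.1 ^ 2 + prodDot v.2 v.2 ≤ R} := by
  refine (Metric.isBounded_closedBall (x := 0) (r := R + 1)).subset fun v hv => ?_
  have h : v.1 ^ 2 + (v.2.1 * v.2.1 + inner ℝ v.2.2 v.2.2) ≤ R := hv
  rw [real_inner_self_eq_norm_sq] at h
  simp only [mem_closedBall_zero_iff, Prod.norm_def, max_le_iff, Real.norm_eq_abs, abs_le]
  refine ⟨⟨?_, ?_⟩, ⟨?_, ?_⟩, ?_⟩ <;>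
    nlinarith [sq_nonneg (v.1 - 1), sq_nonneg (v.1 + 1), sq_nonneg (v.2.1 - 1),
      sq_nonneg (v.2.1 + 1), sq_nonneg (‖v.2.2‖ - 1), sq_nonneg v.1, sq_nonneg v.2.1,
      sq_nonneg ‖v.2.2‖]

/-- Integration along the lines of direction `(1, β)`, over the half-space `a > 0`. -/
lemma integral_lineChart {F : Type*} [NormedAddCommGroup F] [NormedSpace ℝ F] [CompleteSpace F]
    {f : ℝ × (ℝ × E) → ℝ} (hf : IsNice f) (β : E) {w : ℝ × E → F} (hw : Continuous w) :
    ∫ p, (∫ a in Ioi 0, f (lineChart β (p, a))) • w p =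
      ∫ v in {v : ℝ × (ℝ × E) | 0 < v.2.1}, f v • w (v.1, v.2.2 - v.2.1 • β) := by
  rw [(hf.comp_homeomorph (lineChart β)).integral_integral_Ioi_smul volume hw,
    ← (measurePreserving_lineChart β).setIntegral_preimage_emb
      (lineChart β).measurableEmbedding]
  simp [Measure.volume_eq_prod]

/-- Integration along the lines of direction `(1, 0)`, over a half-space. -/
lemma integral_dualChart {F : Type*} [NormedAddCommGroup F] [NormedSpace ℝ F] [CompleteSpace F]
    {f : ℝ × (ℝ × E) → ℝ} (hf : IsNice f) (β : E) {w : ℝ × E → F} (hw : Continuous w) :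
    ∫ p, (∫ a in Ioi 0, f (dualChart β (p, a))) • w p =
      ∫ v in {v : ℝ × (ℝ × E) | 0 < v.2.1 + inner ℝ β v.2.2}, f v • w (v.1, v.2.2) := by
  rw [(hf.comp_homeomorph (dualChart β)).integral_integral_Ioi_smul volume hw,
    ← (measurePreserving_dualChart β).setIntegral_preimage_emb
      (dualChart β).measurableEmbedding]
  simp [Measure.volume_eq_prod]

/-- The reflectFst `(t, (a, x)) ↦ (t, (-a, x))`. -/
def reflectFst (E : Type*) [TopologicalSpace E] : ℝ × (ℝ × E) ≃ₜ ℝ × (ℝ × E) :=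
  (Homeomorph.refl ℝ).prodCongr ((Homeomorph.neg ℝ).prodCongr (Homeomorph.refl E))

omit [InnerProductSpace ℝ E] [FiniteDimensional ℝ E] [MeasurableSpace E] [BorelSpace E] in
@[simp] lemma reflectFst_apply (v : ℝ × (ℝ × E)) : reflectFst E v = (v.1, (-v.2.1, v.2.2)) := rfl

lemma measurePreserving_reflectFst : MeasurePreserving (reflectFst E) :=
  (MeasurePreserving.id volume).prod
    ((Measure.measurePreserving_neg volume).prod (MeasurePreserving.id volume))

lemma setIntegral_reflectFst {F : Type*} [NormedAddCommGroup F] [NormedSpace ℝ F]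
    (f : ℝ × (ℝ × E) → F) (s : Set (ℝ × (ℝ × E))) :
    ∫ v in reflectFst E ⁻¹' s, f (reflectFst E v) = ∫ v in s, f v :=
  measurePreserving_reflectFst.setIntegral_preimage_emb (reflectFst E).measurableEmbedding f s

lemma radial_prodDot_aux {θ : ℝ → ℝ} (hθ : IsNice θ) {g : ℝ → ℝ} (hg : Continuous g) :
    ∫ v in {v : ℝ × (ℝ × E) | 0 < v.1}, g v.1 * θ (v.1 ^ 2 + prodDot v.2 v.2) =
      2 * ∫ v in {v : ℝ × E | 0 < v.1},
        g v.1 * fiberKernel θ (v.1 ^ 2 + inner ℝ v.2 v.2) := by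
  have hS : MeasurableSet {v : ℝ × (ℝ × E) | 0 < v.1} :=
    measurableSet_lt measurable_const measurable_fst
  have hS' : MeasurableSet {v : ℝ × E | 0 < v.1} :=
    measurableSet_lt measurable_const measurable_fst
  have hq : Continuous fun v : ℝ × (ℝ × E) => v.1 ^ 2 + prodDot v.2 v.2 := by
    unfold prodDot; fun_prop
  set f := {v : ℝ × (ℝ × E) | 0 < v.1}.indicator fun v => θ (v.1 ^ 2 + prodDot v.2 v.2) with hf
  have hfn : IsNice f := (hθ.comp_sq hq isBounded_sq_add_prodDot_le).mul_indicator hS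
  have h1 : ∫ v in {v : ℝ × (ℝ × E) | 0 < v.1}, g v.1 * θ (v.1 ^ 2 + prodDot v.2 v.2) =
      ∫ v, f v • g v.1 := by
    rw [← integral_indicator hS]
    congr 1 with v
    by_cases hv : 0 < v.1 <;> simp [hf, hv, mul_comm]
  have hint : Integrable fun v => f v • g v.1 := hfn.integrable_smul _ (hg.comp continuous_fst)
  let ℓ : ℝ × (ℝ × E) →L[ℝ] ℝ := (ContinuousLinearMap.fst ℝ ℝ E).comp
    (ContinuousLinearMap.snd ℝ ℝ (ℝ × E))
  have hℓ : ℓ ≠ 0 := fun h => by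
    have := DFunLike.congr_fun h (0, (1, 0))
    simp [ℓ] at this
  rw [h1, integral_eq_add_of_linearMap volume ℓ hℓ hint]
  have h2 : ∫ v in {v : ℝ × (ℝ × E) | ℓ v < 0}, f v • g v.1 =
      ∫ v in {v : ℝ × (ℝ × E) | 0 < ℓ v}, f v • g v.1 := by
    rw [← setIntegral_reflectFst]
    simp [ℓ, hf, prodDot, indicator]
  rw [h2, ← two_mul]
  congr 1
  have h3 := integral_lineChart hfn 0 (w := fun p => g p.1) (by fun_prop)
  simp only at h3
  rw [show {v | 0 < ℓ v} = {v : ℝ × (ℝ × E) | 0 < v.2.1} from rfl, ← h3, ← integral_indicator hS']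
  congr 1 with p
  by_cases hp : 0 < p.1
  · have hpos : 0 < p.1 ^ 2 + (inner ℝ p.2 p.2 : ℝ) :=
      add_pos_of_pos_of_nonneg (by positivity) real_inner_self_nonneg
    simp only [hf, indicator, lineChart_apply, mem_ofPred_eq, hp, if_true, fiberKernel_apply θ hpos,
      prodDot, smul_zero, add_zero, smul_eq_mul]
    rw [mul_comm]
    congr 2 with a
    congr 1
    ring
  · simp [hf, hp]

lemma radialMoment_prodDot {θ : ℝ → ℝ} (hθ : IsNice θ) :
    radialMoment (prodDot (E := E)) θ =
      2 * radialMoment (fun x y : E => inner ℝ x y) (fiberKernel θ) :=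
  radial_prodDot_aux hθ (g := fun t => t ^ 2) (by fun_prop)

lemma radialMass_prodDot {θ : ℝ → ℝ} (hθ : IsNice θ) :
    radialMass (prodDot (E := E)) θ =
      2 * radialMass (fun x y : E => inner ℝ x y) (fiberKernel θ) := by
  have h := radial_prodDot_aux (E := E) hθ (g := fun _ => 1) continuous_const
  simp only [one_mul] at h
  exact h

/-- One step of the induction, on half-spaces. The function `A` is integrated along lines of
direction `(1, β)` and the function `B` along lines of the dual direction; by the one-dimensional
inequality the partial integrals form a dual pair, and by the choice of `β` the first of them
satisfies the barycenter condition. -/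
lemma santaloBound_half (hE : SantaloInequality E fun x y => inner ℝ x y) {θ : ℝ → ℝ}
    {A B : ℝ × (ℝ × E) → ℝ} (hθ : IsNice θ) (hA : IsNice A) (hB : IsNice B)
    (hA0 : ∀ v, v.1 ≤ 0 → A v = 0) (hB0 : ∀ v, v.1 ≤ 0 → B v = 0)
    (hpair : IsDualPair prodDot θ A B) (β : E)
    (hβ : ∫ v in {v : ℝ × (ℝ × E) | 0 < v.2.1}, A v • v.1 • (v.2.2 - v.2.1 • β) = 0) :
    SantaloBound (∫ v in {v : ℝ × (ℝ × E) | 0 < v.2.1}, v.1 ^ 2 * A v)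
      (∫ v in {v : ℝ × (ℝ × E) | 0 < v.2.1}, A v)
      (∫ w in {w : ℝ × (ℝ × E) | 0 < w.2.1 + inner ℝ β w.2.2}, w.1 ^ 2 * B w)
      (∫ w in {w : ℝ × (ℝ × E) | 0 < w.2.1 + inner ℝ β w.2.2}, B w)
      (radialMoment (prodDot (E := E)) θ / 2) (radialMass (prodDot (E := E)) θ / 2) := by
  have hAc := hA.comp_homeomorph (lineChart β)
  have hBc := hB.comp_homeomorph (dualChart β)
  have h := hE (fiberKernel θ) (fun p => ∫ a in Ioi 0, A (lineChart β (p, a)))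
    (fun p => ∫ a in Ioi 0, B (dualChart β (p, a))) hθ.fiberKernel hAc.integral_Ioi
    hBc.integral_Ioi
    (fun p hp => by simp [hA0 (p.1, _) hp]) (fun p hp => by simp [hB0 (p.1, _) hp]) ?_ ?_
  · rw [radialMoment_prodDot hθ, radialMass_prodDot hθ, mul_div_cancel_left₀ _ two_ne_zero,
      mul_div_cancel_left₀ _ two_ne_zero]
    have e1 := integral_lineChart hA β (w := fun p => p.1 ^ 2) (by fun_prop)
    have e2 := integral_lineChart hA β (w := fun p => (1 : ℝ)) (by fun_prop)
    have e3 := integral_dualChart hB β (w := fun p => p.1 ^ 2) (by fun_prop)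
    have e4 := integral_dualChart hB β (w := fun p => (1 : ℝ)) (by fun_prop)
    simp only [smul_eq_mul, mul_one, mul_comm _ (_ ^ 2)] at e1 e2 e3 e4
    rwa [e1, e2, e3, e4] at h
  · intro p q hp hq hpq
    simp only [fiberKernel_apply θ hpq]
    have hsec : ∀ {f : (ℝ × E) × ℝ → ℝ}, IsNice f → ∀ p : ℝ × E, IsNice fun a => f (p, a) :=
      fun {f} hf p =>
        { measurable := hf.measurable.comp (by fun_prop)
          nonneg := fun t => hf.nonneg _
          bounded := hf.bounded.imp fun M hM t => hM _
          support := (hf.support.image_snd).subset fun t ht => ⟨(p, t), ht, rfl⟩ }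
    have hχ : IsNice fun r : ℝ => θ (p.1 * q.1 + inner ℝ p.2 q.2 + r ^ 2) :=
      hθ.comp_sq (by fun_prop) fun R => by
        refine (Metric.isBounded_closedBall (x := (0 : ℝ)) (r := R + 1)).subset fun x hx => ?_
        rw [mem_closedBall_zero_iff, Real.norm_eq_abs, abs_le]
        have : p.1 * q.1 + inner ℝ p.2 q.2 + x ^ 2 ≤ R := hx
        constructor <;> nlinarith [sq_nonneg (x - 1), sq_nonneg (x + 1)]
    refine (integral_mul_integral_le_sq_integral_sqrt (hsec hAc p).measurable
      (hsec hBc q).measurable hχ.measurable (hsec hAc p).nonneg (hsec hBc q).nonneg hχ.nonneg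
      ((hsec hAc p).integrable _).integrableOn ((hsec hBc q).integrable _).integrableOn
      (hχ.integrable _).integrableOn fun a b ha hb => ?_).1
    have hdot : (lineChart β (p, a)).1 * (dualChart β (q, b)).1 +
        prodDot (lineChart β (p, a)).2 (dualChart β (q, b)).2 =
        p.1 * q.1 + inner ℝ p.2 q.2 + a * b := by
      simp only [lineChart_apply, dualChart_apply, prodDot, inner_add_left, real_inner_smul_left]
      ring
    have hab := mul_pos ha hb
    rw [Real.sq_sqrt hab.le, ← hdot]
    exact hpair _ _ hp hq (by rw [hdot]; linarith)
  · rw [integral_lineChart hA β (w := fun p => p.1 • p.2) (by fun_prop)]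
    exact hβ

end Half

/-! ### The inductive step -/

/-- A weight of bounded mass is halved by some member of the pencil of hyperplanes `p = a q`. -/
lemma exists_setIntegral_eq_half {X : Type*} [MeasurableSpace X] {μ : Measure X} {p q f : X → ℝ}
    (hp : Measurable p) (hq : Measurable q) (hf : Integrable f μ) (hf0 : ∀ x, 0 ≤ f x)
    (hfq : ∀ x, q x ≤ 0 → f x = 0) (hnull : ∀ a : ℝ, μ {x | p x = a * q x} = 0) :
    ∃ a : ℝ, ∫ x in {x | a * q x < p x}, f x ∂μ = (∫ x, f x ∂μ) / 2 := by
  have hm : ∀ a : ℝ, MeasurableSet {x | a * q x < p x} := fun a =>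
    measurableSet_lt (hq.const_mul a) hp
  set F : ℝ → X → ℝ := fun a => {x | a * q x < p x}.indicator f with hF
  have hFm : ∀ a, AEStronglyMeasurable (F a) μ := fun a =>
    hf.aestronglyMeasurable.indicator (hm a)
  have hFb : ∀ a, ∀ᵐ x ∂μ, ‖F a x‖ ≤ f x := fun a => ae_of_all _ fun x => by
    rw [Real.norm_of_nonneg (indicator_nonneg (fun x _ => hf0 x) x)]
    exact indicator_le_self' (fun x _ => hf0 x) x
  have hcont : Continuous fun a => ∫ x, F a x ∂μ := by
    refine continuous_iff_continuousAt.2 fun a => ?_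
    refine continuousAt_of_dominated (Eventually.of_forall hFm) (Eventually.of_forall hFb) hf ?_
    filter_upwards [measure_eq_zero_iff_ae_notMem.1 (hnull a)] with x hx
    have hx : p x ≠ a * q x := hx
    have hc : ContinuousAt (fun b : ℝ => b * q x) a := by fun_prop
    rcases hx.lt_or_gt with hlt | hgt
    · refine (continuousAt_const (y := (0 : ℝ))).congr ?_
      filter_upwards [hc.eventually (lt_mem_nhds hlt)] with b hb
      simp [hF, hb.le]
    · refine (continuousAt_const (y := f x)).congr ?_
      filter_upwards [hc.eventually (gt_mem_nhds hgt)] with b hb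
      simp [hF, hb]
  have htop : Tendsto (fun a => ∫ x, F a x ∂μ) atTop (nhds (∫ _, (0 : ℝ) ∂μ)) := by
    refine tendsto_integral_filter_of_dominated_convergence f (Eventually.of_forall hFm)
      (Eventually.of_forall hFb) hf (ae_of_all _ fun x => tendsto_const_nhds.congr' ?_)
    rcases le_or_gt (q x) 0 with h | h
    · exact Eventually.of_forall fun a => by simp [hF, indicator, hfq x h]
    · filter_upwards [eventually_ge_atTop (p x / q x)] with a ha
      rw [div_le_iff₀ h] at ha
      simp [hF, ha]
  have hbot : Tendsto (fun a => ∫ x, F a x ∂μ) atBot (nhds (∫ x, f x ∂μ)) := by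
    refine tendsto_integral_filter_of_dominated_convergence f (Eventually.of_forall hFm)
      (Eventually.of_forall hFb) hf (ae_of_all _ fun x => tendsto_const_nhds.congr' ?_)
    rcases le_or_gt (q x) 0 with h | h
    · exact Eventually.of_forall fun a => by simp [hF, indicator, hfq x h]
    · filter_upwards [eventually_lt_atBot (p x / q x)] with a ha
      rw [lt_div_iff₀ h] at ha
      simp [hF, ha]
  have hM : 0 ≤ ∫ x, f x ∂μ := integral_nonneg hf0
  rcases hM.eq_or_lt with h0 | hpos
  · refine ⟨0, ?_⟩
    have h1 := setIntegral_mono_set (s := {x | 0 * q x < p x}) (t := univ) hf.integrableOn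
      (ae_of_all _ hf0) (subset_univ _).eventuallyLE
    rw [setIntegral_univ, ← h0] at h1
    rw [← h0, zero_div]
    exact le_antisymm h1 (integral_nonneg hf0)
  · rw [integral_zero] at htop
    obtain ⟨a₁, h₁⟩ := (htop.eventually (gt_mem_nhds (half_pos hpos))).exists
    obtain ⟨a₂, h₂⟩ := (hbot.eventually (lt_mem_nhds (half_lt_self hpos))).exists
    obtain ⟨a, ha⟩ := mem_range_of_exists_le_of_exists_ge hcont ⟨a₁, h₁.le⟩ ⟨a₂, h₂.le⟩
    refine ⟨a, ?_⟩
    rw [← ha]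
    exact (integral_indicator (hm a)).symm

/-- The bounds for two complementary half-spaces add up to the bound for the whole space, provided
that the second moment of the first function is divided into equal halves. -/
lemma SantaloBound.add {m p₀ n₀ b₂ b₀ c₂ c₀ J I : ℝ} (hp : 0 ≤ p₀) (hn : 0 ≤ n₀) (hb : 0 ≤ b₀)
    (hc : 0 ≤ c₀) (h₁ : SantaloBound m p₀ b₂ b₀ (J / 2) (I / 2))
    (h₂ : SantaloBound m n₀ c₂ c₀ (J / 2) (I / 2)) :
    SantaloBound (m + m) (p₀ + n₀) (b₂ + c₂) (b₀ + c₀) J I := by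
  obtain ⟨h₁, e₁⟩ := h₁
  obtain ⟨h₂, e₂⟩ := h₂
  refine ⟨by nlinarith, fun hJ heq => ?_⟩
  have i₁ := e₁ (half_pos hJ) (by nlinarith)
  have i₂ := e₂ (half_pos hJ) (by nlinarith)
  have hcross : I ^ 2 / 2 ≤ p₀ * c₀ + n₀ * b₀ := by
    refine abs_le_of_sq_le_sq' ?_ (by positivity) |>.2
    have h3 : (I / 2) ^ 2 * (I / 2) ^ 2 ≤ (p₀ * b₀) * (n₀ * c₀) :=
      mul_le_mul i₁ i₂ (sq_nonneg _) (by positivity)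
    nlinarith [sq_nonneg (p₀ * c₀ - n₀ * b₀)]
  nlinarith

section Step

variable {E : Type*} [NormedAddCommGroup E] [InnerProductSpace ℝ E] [FiniteDimensional ℝ E]
  [MeasurableSpace E] [BorelSpace E]

/-- The continuous linear functional `⟨z, ·⟩` on `ℝ × E`. -/
noncomputable def prodDotCLM (z : ℝ × E) : ℝ × E →L[ℝ] ℝ :=
  (z.1 • ContinuousLinearMap.fst ℝ ℝ E) + (innerSL ℝ z.2).comp (ContinuousLinearMap.snd ℝ ℝ E)

omit [FiniteDimensional ℝ E] [MeasurableSpace E] [BorelSpace E] in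
lemma prodDotCLM_apply (z v : ℝ × E) : prodDotCLM z v = prodDot z v := by
  simp [prodDotCLM, prodDot]

omit [FiniteDimensional ℝ E] [MeasurableSpace E] [BorelSpace E] in
lemma prodDot_comm (v w : ℝ × E) : prodDot v w = prodDot w v := by
  simp only [prodDot, mul_comm, real_inner_comm]

/-- The continuous linear functional `(t, (b, x)) ↦ b - a t`. -/
noncomputable def pencil (E : Type*) [NormedAddCommGroup E] [InnerProductSpace ℝ E] (a : ℝ) :
    ℝ × (ℝ × E) →L[ℝ] ℝ :=
  (ContinuousLinearMap.fst ℝ ℝ E).comp (ContinuousLinearMap.snd ℝ ℝ (ℝ × E)) -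
    a • ContinuousLinearMap.fst ℝ ℝ (ℝ × E)

omit [FiniteDimensional ℝ E] [MeasurableSpace E] [BorelSpace E] in
lemma pencil_apply (a : ℝ) (v : ℝ × (ℝ × E)) : pencil E a v = v.2.1 - a * v.1 := by
  simp [pencil]

omit [FiniteDimensional ℝ E] [MeasurableSpace E] [BorelSpace E] in
lemma pencil_ne_zero (a : ℝ) : pencil E a ≠ 0 := fun h => by
  have := DFunLike.congr_fun h (0, (1, 0))
  simp [pencil_apply] at this

/-- The counterpart of `santaloBound_half` for the complementary half-spaces. -/
lemma santaloBound_half_neg (hE : SantaloInequality E fun x y => inner ℝ x y) {θ : ℝ → ℝ}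
    {A B : ℝ × (ℝ × E) → ℝ} (hθ : IsNice θ) (hA : IsNice A) (hB : IsNice B)
    (hA0 : ∀ v, v.1 ≤ 0 → A v = 0) (hB0 : ∀ v, v.1 ≤ 0 → B v = 0)
    (hpair : IsDualPair prodDot θ A B) (β : E)
    (hβ : ∫ v in {v : ℝ × (ℝ × E) | v.2.1 < 0}, A v • v.1 • (v.2.2 - v.2.1 • β) = 0) :
    SantaloBound (∫ v in {v : ℝ × (ℝ × E) | v.2.1 < 0}, v.1 ^ 2 * A v)
      (∫ v in {v : ℝ × (ℝ × E) | v.2.1 < 0}, A v)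
      (∫ w in {w : ℝ × (ℝ × E) | w.2.1 + inner ℝ β w.2.2 < 0}, w.1 ^ 2 * B w)
      (∫ w in {w : ℝ × (ℝ × E) | w.2.1 + inner ℝ β w.2.2 < 0}, B w)
      (radialMoment (prodDot (E := E)) θ / 2) (radialMass (prodDot (E := E)) θ / 2) := by
  have hs : reflectFst E ⁻¹' {v | v.2.1 < 0} = {v | 0 < v.2.1} := by ext; simp
  have hs' : reflectFst E ⁻¹' {w | w.2.1 + inner ℝ β w.2.2 < 0} =
      {w | 0 < w.2.1 + inner ℝ (-β) w.2.2} := by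
    ext w
    simp only [mem_preimage, reflectFst_apply, mem_ofPred_eq, inner_neg_left]
    constructor <;> intro h <;> linarith
  rw [← setIntegral_reflectFst, hs] at hβ
  rw [← setIntegral_reflectFst, ← setIntegral_reflectFst _ {v : ℝ × (ℝ × E) | v.2.1 < 0},
    ← setIntegral_reflectFst _ {w : ℝ × (ℝ × E) | w.2.1 + inner ℝ β w.2.2 < 0},
    ← setIntegral_reflectFst _ {w : ℝ × (ℝ × E) | w.2.1 + inner ℝ β w.2.2 < 0}, hs, hs']
  refine santaloBound_half hE hθ (hA.comp_homeomorph (reflectFst E))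
    (hB.comp_homeomorph (reflectFst E)) (fun v hv => hA0 _ hv) (fun v hv => hB0 _ hv) ?_ (-β) ?_
  · intro v w hv hw hvw
    have hdot : prodDot (reflectFst E v).2 (reflectFst E w).2 = prodDot v.2 w.2 := by
      simp [prodDot]
    have := hpair (reflectFst E v) (reflectFst E w) hv hw
    rw [hdot] at this
    exact this hvw
  · simpa using hβ

/-- For every weight `A` there is a center `z` such that the inequality holds for all functions dual
to `A` sheared to the center `z`. The second moment of `A` is halved by a hyperplane, and `z` and
the direction `(1, β)` are determined by the barycenters of the two halves. -/
lemma exists_center (hE : SantaloInequality E fun x y => inner ℝ x y) {θ : ℝ → ℝ}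
    {A : ℝ × (ℝ × E) → ℝ} (hθ : IsNice θ) (hA : IsNice A) (hA0 : ∀ v, v.1 ≤ 0 → A v = 0) :
    ∃ z : ℝ × E, ∀ B : ℝ × (ℝ × E) → ℝ, IsNice B → (∀ v, v.1 ≤ 0 → B v = 0) →
      IsDualPair prodDot θ (fun v => A (v.1, v.2 + v.1 • z)) B →
      SantaloBound (∫ v, v.1 ^ 2 * A v) (∫ v, A v) (∫ v, v.1 ^ 2 * B v) (∫ v, B v)
        (radialMoment (prodDot (E := E)) θ) (radialMass (prodDot (E := E)) θ) := by
  set M := ∫ v, v.1 ^ 2 * A v with hM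
  have hM0 : 0 ≤ M := integral_nonneg fun v => mul_nonneg (sq_nonneg _) (hA.nonneg v)
  rcases hM0.eq_or_lt with h0 | hMpos
  · refine ⟨0, fun B _ _ _ => ?_⟩
    rw [← h0]
    exact ⟨by rw [zero_mul]; exact sq_nonneg _, fun hJ he => by
      rw [zero_mul] at he; exact absurd he (pow_pos hJ 2).ne⟩
  have hint : ∀ {f : ℝ × (ℝ × E) → ℝ}, IsNice f → Integrable fun v => v.1 ^ 2 * f v :=
    fun hf => hf.integrable_mul volume (by fun_prop)
  obtain ⟨α, hα⟩ := exists_setIntegral_eq_half (p := fun v : ℝ × (ℝ × E) => v.2.1)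
    (q := fun v => v.1) (by fun_prop) (by fun_prop) (hint hA)
    (fun v => mul_nonneg (sq_nonneg _) (hA.nonneg v))
    (fun v hv => by simp [hA0 v hv])
    (fun a => by
      simpa [pencil_apply, sub_eq_zero] using
        measure_setOf_linearMap_eq_zero volume (pencil E a) (pencil_ne_zero a))
  rw [← hM] at hα
  set P : Set (ℝ × (ℝ × E)) := {v | α * v.1 < v.2.1} with hP
  set N : Set (ℝ × (ℝ × E)) := {v | v.2.1 < α * v.1} with hN
  have hPm : MeasurableSet P := measurableSet_lt (by fun_prop) (by fun_prop)
  have hNm : MeasurableSet N := measurableSet_lt (by fun_prop) (by fun_prop)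
  have hsplit : ∀ {f : ℝ × (ℝ × E) → ℝ}, Integrable f → ∫ v, f v = (∫ v in P, f v) + ∫ v in N, f v :=
    fun hf => by
      have h := integral_eq_add_of_linearMap volume (pencil E α) (pencil_ne_zero α) hf
      simpa only [pencil_apply, sub_pos, sub_neg] using h
  have hα' : ∫ v in N, v.1 ^ 2 * A v = M / 2 := by
    have := hsplit (hint hA)
    linarith
  -- first moments of the two halves, transversal and along the hyperplane
  set c₁ := ∫ v in P, A v * (v.1 * (v.2.1 - v.1 * α)) with hc₁
  set c₂ := ∫ v in N, A v * (v.1 * (v.2.1 - v.1 * α)) with hc₂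
  set e₁ := ∫ v in P, A v • v.1 • v.2.2 with he₁
  set e₂ := ∫ v in N, A v • v.1 • v.2.2 with he₂
  have hci : Integrable fun v => A v * (v.1 * (v.2.1 - v.1 * α)) :=
    hA.integrable_smul volume (w := fun v => v.1 * (v.2.1 - v.1 * α)) (by fun_prop)
  have hei : Integrable fun v => A v • v.1 • v.2.2 :=
    hA.integrable_smul volume (w := fun v => v.1 • v.2.2) (by fun_prop)
  have hc₁pos : 0 < c₁ := by
    have hnn : ∀ v ∈ P, 0 ≤ A v * (v.1 * (v.2.1 - v.1 * α)) := fun v hv => by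
      rcases le_or_gt v.1 0 with h | h
      · rw [hA0 v h, zero_mul]
      · have : α * v.1 < v.2.1 := hv
        exact mul_nonneg (hA.nonneg v) (mul_nonneg h.le (by linarith))
    refine lt_of_le_of_ne (setIntegral_nonneg hPm hnn) fun h => ?_
    rw [hc₁, eq_comm, integral_eq_zero_iff_of_nonneg_ae
      ((ae_restrict_mem hPm).mono hnn) hci.integrableOn] at h
    have : ∫ v in P, v.1 ^ 2 * A v = 0 := by
      refine integral_eq_zero_of_ae ?_
      filter_upwards [h, ae_restrict_mem hPm] with v hv hvP
      have hlt : α * v.1 < v.2.1 := hvP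
      rcases mul_eq_zero.1 hv with h1 | h1
      · simp [h1]
      · rcases mul_eq_zero.1 h1 with h2 | h2
        · simp [h2]
        · exact absurd h2 (by linarith)
    linarith
  have hc₂neg : c₂ ≤ 0 := setIntegral_nonpos hNm fun v hv => by
    rcases le_or_gt v.1 0 with h | h
    · rw [hA0 v h, zero_mul]
    · have : v.2.1 < α * v.1 := hv
      exact mul_nonpos_of_nonneg_of_nonpos (hA.nonneg v)
        (mul_nonpos_of_nonneg_of_nonpos h.le (by linarith))
  -- `β` and `ζ` solve the two barycenter equations
  set β : E := (c₁ - c₂)⁻¹ • (e₁ - e₂) with hβ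
  set ζ : E := (M / 2)⁻¹ • (e₁ - c₁ • β) with hζ
  have heq₁ : e₁ - (M / 2) • ζ - c₁ • β = 0 := by
    rw [hζ, smul_inv_smul₀ (half_pos hMpos).ne']; abel
  have heq₂ : e₂ - (M / 2) • ζ - c₂ • β = 0 := by
    have h1 : (c₁ - c₂) • β = e₁ - e₂ := by
      rw [hβ, smul_inv_smul₀ (by linarith)]
    rw [hζ, smul_inv_smul₀ (half_pos hMpos).ne', ← sub_eq_zero.2 h1, sub_smul]; abel
  refine ⟨(α, ζ), fun B hB hB0 hpair => ?_⟩
  let σ : ℝ × (ℝ × E) ≃ₜ ℝ × (ℝ × E) := shearSnd (fun t : ℝ => t • ((α, ζ) : ℝ × E)) (by fun_prop)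
  have hσ : MeasurePreserving σ := measurePreserving_shearSnd volume volume _ _
  have hA' : IsNice fun v => A (σ v) := hA.comp_homeomorph σ
  have hcv : ∀ (f : ℝ × (ℝ × E) → ℝ) (s : Set (ℝ × (ℝ × E))),
      ∫ v in σ ⁻¹' s, f (σ v) = ∫ v in s, f v := fun f s =>
    hσ.setIntegral_preimage_emb σ.measurableEmbedding f s
  have hcvE : ∀ (f : ℝ × (ℝ × E) → E) (s : Set (ℝ × (ℝ × E))),
      ∫ v in σ ⁻¹' s, f (σ v) = ∫ v in s, f v := fun f s =>
    hσ.setIntegral_preimage_emb σ.measurableEmbedding f s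
  have hσP : σ ⁻¹' P = {v | 0 < v.2.1} := by
    ext v; simp [σ, shearSnd, hP, mul_comm]
  have hσN : σ ⁻¹' N = {v | v.2.1 < 0} := by
    ext v; simp [σ, shearSnd, hN, mul_comm]
  -- the barycenter integrals in the sheared coordinates
  have hbary : ∀ (s : Set (ℝ × (ℝ × E))), ∫ v in σ ⁻¹' s, A (σ v) • v.1 • (v.2.2 - v.2.1 • β) =
      (∫ v in s, A v • v.1 • v.2.2) - (∫ v in s, v.1 ^ 2 * A v) • ζ -
        (∫ v in s, A v * (v.1 * (v.2.1 - v.1 * α))) • β := fun s => by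
    have hsub : IntegrableOn (fun v => A v • v.1 • v.2.2 - (v.1 ^ 2 * A v) • ζ) s :=
      (hei.sub ((hint hA).smul_const ζ)).integrableOn
    rw [← integral_smul_const, ← integral_smul_const, ← integral_sub hei.integrableOn
      ((hint hA).smul_const ζ).integrableOn, ← integral_sub hsub
      (hci.smul_const β).integrableOn, ← hcvE _ s]
    refine integral_congr_ae (ae_of_all _ fun v => ?_)
    have h1 : (σ v).1 = v.1 := rfl
    have h2 : (σ v).2.1 = v.2.1 + v.1 * α := rfl
    have h3 : (σ v).2.2 = v.2.2 + v.1 • ζ := rfl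
    simp only [h1, h2, h3]
    module
  have hAσ0 : ∀ v : ℝ × (ℝ × E), v.1 ≤ 0 → A (σ v) = 0 := fun v hv => hA0 _ hv
  have hpl := santaloBound_half hE hθ hA' hB hAσ0 hB0 hpair β
    (by rw [← hσP, hbary, hα, ← heq₁])
  have hmi := santaloBound_half_neg hE hθ hA' hB hAσ0 hB0 hpair β
    (by rw [← hσN, hbary, hα', ← heq₂])
  have hmP : ∫ v in {v : ℝ × (ℝ × E) | 0 < v.2.1}, v.1 ^ 2 * A (σ v) = M / 2 := by
    rw [← hσP, ← hα]; exact hcv (fun v => v.1 ^ 2 * A v) P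
  have hmN : ∫ v in {v : ℝ × (ℝ × E) | v.2.1 < 0}, v.1 ^ 2 * A (σ v) = M / 2 := by
    rw [← hσN, ← hα']; exact hcv (fun v => v.1 ^ 2 * A v) N
  rw [hmP] at hpl
  rw [hmN] at hmi
  have hfin := SantaloBound.add (integral_nonneg fun v => hA'.nonneg v)
    (integral_nonneg fun v => hA'.nonneg v) (integral_nonneg fun v => hB.nonneg v)
    (integral_nonneg fun v => hB.nonneg v) hpl hmi
  have hAtot : (∫ v in {v : ℝ × (ℝ × E) | 0 < v.2.1}, A (σ v)) +
      ∫ v in {v : ℝ × (ℝ × E) | v.2.1 < 0}, A (σ v) = ∫ v, A v := by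
    rw [← hσP, ← hσN, hcv A, hcv A, ← hsplit (hA.integrable _)]
  let ℓ : ℝ × (ℝ × E) →L[ℝ] ℝ := (prodDotCLM (1, β)).comp (ContinuousLinearMap.snd ℝ ℝ (ℝ × E))
  have hℓ : ℓ ≠ 0 := fun h => by
    have := DFunLike.congr_fun h (0, (1, 0))
    simp [ℓ, prodDotCLM_apply, prodDot] at this
  have hℓv : ∀ v, ℓ v = v.2.1 + inner ℝ β v.2.2 := fun v => by
    simp [ℓ, prodDotCLM_apply, prodDot]
  have hB₂ := integral_eq_add_of_linearMap volume ℓ hℓ (hint hB)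
  have hB₀ := integral_eq_add_of_linearMap volume ℓ hℓ (hB.integrable volume)
  simp only [hℓv] at hB₂ hB₀
  rwa [hAtot, ← hB₂, ← hB₀, add_halves] at hfin

/-- The inductive step `E → ℝ × E`. The center of `B` supplied by `exists_center` turns `A` into a
function whose second moment is not smaller, because `(1 + r)₊² ≥ 1 + 2r` and the linear term
integrates to zero by the barycenter condition. -/
theorem santaloInequality_prod (hE : SantaloInequality E fun x y => inner ℝ x y) :
    SantaloInequality (ℝ × E) prodDot := by
  intro θ A B hθ hA hB hA0 hB0 hpair hbary
  obtain ⟨z, hz⟩ := exists_center hE hθ hB hB0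
  have hcz : Continuous fun v : ℝ × E => -prodDotCLM z v := by fun_prop
  let τ : ℝ × (ℝ × E) ≃ₜ ℝ × (ℝ × E) := shearFst (fun v => -prodDotCLM z v) hcz
  have hτ : MeasurePreserving τ := measurePreserving_shearFst volume volume _ _
  have hτv : ∀ v, τ v = (v.1 + -prodDotCLM z v.2, v.2) := fun v => rfl
  have hS : MeasurableSet {v : ℝ × (ℝ × E) | 0 < v.1} :=
    measurableSet_lt measurable_const measurable_fst
  set D := {v : ℝ × (ℝ × E) | 0 < v.1}.indicator fun v => A (τ v) with hD
  have hDn : IsNice D := (hA.comp_homeomorph τ).mul_indicator hS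
  have hb := hz D hDn (fun v hv => by simp [hD, hv]) ?_
  · -- change of variables in the moments of `D`
    have hDint : ∀ g : ℝ → ℝ, ∫ v, g v.1 * D v =
        ∫ v, {v : ℝ × (ℝ × E) | 0 < v.1 + prodDotCLM z v.2}.indicator
          (fun v => g (v.1 + prodDotCLM z v.2) * A v) v := fun g => by
      symm
      rw [← hτ.integral_comp τ.measurableEmbedding]
      refine integral_congr_ae (ae_of_all _ fun v => ?_)
      simp only [hD, hτv, indicator, mem_ofPred_eq, neg_add_cancel_right]
      split_ifs <;> simp
    have hi₀ : Integrable A := hA.integrable volume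
    have hi₂ : Integrable fun v => v.1 ^ 2 * A v := hA.integrable_mul volume (by fun_prop)
    have hi₁ : Integrable fun v => A v * (v.1 * prodDotCLM z v.2) :=
      hA.integrable_smul volume (w := fun v => v.1 * prodDotCLM z v.2) (by fun_prop)
    have hS' : MeasurableSet {v : ℝ × (ℝ × E) | 0 < v.1 + prodDotCLM z v.2} :=
      measurableSet_lt measurable_const (by fun_prop)
    have hlin : ∫ v, A v * (v.1 * prodDotCLM z v.2) = 0 := by
      have h := (prodDotCLM z).integral_comp_comm
        (hA.integrable_smul volume (w := fun v => v.1 • v.2) (by fun_prop))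
      rw [hbary, map_zero] at h
      rw [← h]
      simp
    have hmom : ∫ v, v.1 ^ 2 * A v ≤ ∫ v, v.1 ^ 2 * D v := by
      have h1 : ∫ v, v.1 ^ 2 * A v =
          ∫ v, (v.1 ^ 2 * A v + 2 * (A v * (v.1 * prodDotCLM z v.2))) := by
        rw [integral_add hi₂ (hi₁.const_mul 2), integral_const_mul, hlin, mul_zero, add_zero]
      rw [h1, hDint fun t => t ^ 2]
      refine integral_mono (hi₂.add (hi₁.const_mul 2)) ?_ fun v => ?_
      · exact (hA.integrable_mul volume (w := fun v => (v.1 + prodDotCLM z v.2) ^ 2)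
          (by fun_prop)).indicator hS'
      · rcases le_or_gt v.1 0 with hv | hv
        · simp [indicator, hA0 v hv]
        · have hAv := hA.nonneg v
          by_cases hvz : 0 < v.1 + prodDotCLM z v.2
          · simp only [indicator, mem_ofPred_eq, hvz, if_true]
            nlinarith [mul_nonneg (sq_nonneg (prodDotCLM z v.2)) hAv]
          · simp only [indicator, mem_ofPred_eq, hvz, if_false]
            have : v.1 ^ 2 * A v + 2 * (A v * (v.1 * prodDotCLM z v.2)) =
                A v * (v.1 * (v.1 + 2 * prodDotCLM z v.2)) := by ring
            rw [this]
            exact mul_nonpos_of_nonneg_of_nonpos hAv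
              (mul_nonpos_of_nonneg_of_nonpos hv.le (by linarith))
    have hmass : ∫ v, D v ≤ ∫ v, A v := by
      have h := hDint fun _ => 1
      simp only [one_mul] at h
      rw [h]
      refine integral_mono (hi₀.indicator hS') hi₀ fun v => ?_
      exact indicator_le_self' (fun v _ => hA.nonneg v) v
    have hB2 : 0 ≤ ∫ v, v.1 ^ 2 * B v :=
      integral_nonneg fun v => mul_nonneg (sq_nonneg _) (hB.nonneg v)
    have hB0' : 0 ≤ ∫ v, B v := integral_nonneg hB.nonneg
    obtain ⟨hb1, hb2⟩ := hb
    refine ⟨?_, fun hJ heq => ?_⟩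
    · calc _ ≤ (∫ v, v.1 ^ 2 * D v) * ∫ v, v.1 ^ 2 * B v := by gcongr
        _ ≤ _ := by rw [mul_comm]; exact hb1
    · refine (hb2 hJ (le_antisymm hb1 ?_)).trans ?_
      · rw [← heq, mul_comm]; gcongr
      · rw [mul_comm]; gcongr
  · intro w v hw hv hwv
    have hdot : v.1 * w.1 + prodDot v.2 w.2 =
        (τ v).1 * w.1 + prodDot (τ v).2 (w.2 + w.1 • z) := by
      rw [← prodDotCLM_apply, ← prodDotCLM_apply, map_add, map_smul, prodDotCLM_apply _ z,
        prodDot_comm, ← prodDotCLM_apply]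
      simp only [hτv, smul_eq_mul]
      ring
    rw [prodDot_comm, mul_comm w.1] at hwv ⊢
    have hDv : D v = A (τ v) := by simp [hD, hv]
    simp only [hDv]
    rcases le_or_gt (τ v).1 0 with h | h
    · rw [hA0 _ h, mul_zero]
      exact sq_nonneg _
    · rw [mul_comm, hdot]
      exact hpair (τ v) (w.1, w.2 + w.1 • z) h hw (by rw [← hdot]; exact hwv)

end Step

/-! ### The functional inequality in all dimensions -/

/-- The inequality is invariant under volume preserving linear isomorphisms which respect the
pairings. -/
lemma SantaloInequality.congr {V W : Type*} [NormedAddCommGroup V] [NormedSpace ℝ V]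
    [MeasureSpace V] [BorelSpace V] [FiniteDimensional ℝ V] [(volume : Measure V).IsAddHaarMeasure]
    [NormedAddCommGroup W] [NormedSpace ℝ W]
    [MeasureSpace W] [BorelSpace W] [FiniteDimensional ℝ W] [(volume : Measure W).IsAddHaarMeasure]
    {dotV : V → V → ℝ} {dotW : W → W → ℝ} (e : V ≃L[ℝ] W) (he : MeasurePreserving e)
    (hdot : ∀ x y, dotW (e x) (e y) = dotV x y) (h : SantaloInequality W dotW) :
    SantaloInequality V dotV := by
  have := FiniteDimensional.proper_real V
  have := FiniteDimensional.proper_real W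
  intro θ A B hθ hA hB hA0 hB0 hpair hbary
  let Φ : ℝ × V ≃ₜ ℝ × W := (Homeomorph.refl ℝ).prodCongr e.toHomeomorph
  have hΦ : MeasurePreserving Φ := (MeasurePreserving.id volume).prod he
  have hs : ∀ w : ℝ × W, (Φ.symm w).1 = w.1 := fun w => rfl
  have hs₂ : ∀ w : ℝ × W, e (Φ.symm w).2 = w.2 := fun w => e.apply_symm_apply w.2
  have hcv : ∀ f : ℝ × W → ℝ, ∫ w, f w = ∫ v, f (Φ v) := fun f =>
    (hΦ.integral_comp Φ.measurableEmbedding f).symm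
  have hcvE : ∀ f : ℝ × W → W, ∫ w, f w = ∫ v, f (Φ v) := fun f =>
    (hΦ.integral_comp Φ.measurableEmbedding f).symm
  have hrad : ∀ g : ℝ × W → ℝ, ∫ w in {w : ℝ × W | 0 < w.1}, g w =
      ∫ v in {v : ℝ × V | 0 < v.1}, g (Φ v) := fun g =>
    (hΦ.setIntegral_preimage_emb Φ.measurableEmbedding g {w | 0 < w.1}).symm
  have key := h θ (fun w => A (Φ.symm w)) (fun w => B (Φ.symm w)) hθ (hA.comp_homeomorph Φ.symm)
    (hB.comp_homeomorph Φ.symm) (fun w hw => hA0 _ hw) (fun w hw => hB0 _ hw) ?_ ?_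
  · rw [hcv, hcv, hcv, hcv, radialMoment, radialMass, hrad, hrad] at key
    simp only [Homeomorph.symm_apply_apply] at key
    have h1 : ∀ v, (Φ v).1 = v.1 := fun v => rfl
    have h2 : ∀ v, (Φ v).2 = e v.2 := fun v => rfl
    simp only [h1, h2, hdot] at key
    exact key
  · intro v w hv hw hvw
    have h1 : dotW v.2 w.2 = dotV (Φ.symm v).2 (Φ.symm w).2 := by rw [← hdot, hs₂, hs₂]
    rw [h1] at hvw ⊢
    exact hpair (Φ.symm v) (Φ.symm w) hv hw hvw
  · rw [hcvE]
    simp only [Homeomorph.symm_apply_apply]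
    have h1 := e.toContinuousLinearMap.integral_comp_comm
      (hA.integrable_smul volume (w := fun v => v.1 • v.2) (by fun_prop))
    rw [hbary, map_zero] at h1
    rw [← h1]
    refine integral_congr_ae (ae_of_all _ fun v => ?_)
    have h2 : (Φ v).2 = e v.2 := rfl
    have h3 : (Φ v).1 = v.1 := rfl
    simp [h2, h3]

/-- The splitting of the first coordinate, `ℝ^{d + 1} ≃ ℝ × ℝ^d`. -/
noncomputable def splitFst (d : ℕ) :
    EuclideanSpace ℝ (Fin (d + 1)) ≃L[ℝ] ℝ × EuclideanSpace ℝ (Fin d) :=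
  LinearEquiv.toContinuousLinearEquiv
    { toFun := fun x => (x 0, WithLp.toLp 2 fun i => x i.succ)
      invFun := fun p => WithLp.toLp 2 (Fin.cons p.1 p.2)
      map_add' := fun x y => rfl
      map_smul' := fun c x => rfl
      left_inv := fun x => by
        ext i
        refine Fin.cases ?_ (fun j => ?_) i <;> simp
      right_inv := fun p => by
        ext <;> simp }

lemma splitFst_apply (d : ℕ) (x : EuclideanSpace ℝ (Fin (d + 1))) :
    splitFst d x = (x 0, WithLp.toLp 2 fun i => x i.succ) := rfl

lemma prodDot_splitFst (d : ℕ) (x y : EuclideanSpace ℝ (Fin (d + 1))) :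
    prodDot (splitFst d x) (splitFst d y) = inner ℝ x y := by
  simp [prodDot, splitFst_apply, PiLp.inner_apply, Fin.sum_univ_succ, mul_comm]

lemma measurePreserving_splitFst (d : ℕ) : MeasurePreserving (splitFst d) := by
  have h := ((MeasurePreserving.id (volume : Measure ℝ)).prod
    (PiLp.volume_preserving_toLp (Fin d))).comp
      ((volume_preserving_piFinSuccAbove (fun _ : Fin (d + 1) => ℝ) 0).comp
        (PiLp.volume_preserving_ofLp (Fin (d + 1))))
  exact h

/-- The functional inequality for second moments, in all dimensions. -/
theorem santaloInequality_euclidean (d : ℕ) :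
    SantaloInequality (EuclideanSpace ℝ (Fin d)) (fun x y => inner ℝ x y) := by
  induction d with
  | zero => exact santaloInequality_of_subsingleton _
  | succ d ih =>
    exact (santaloInequality_prod ih).congr (splitFst d) (measurePreserving_splitFst d)
      (prodDot_splitFst d)

/-! ### Polar bodies -/

section Polar

variable {n : ℕ} {K : Set (EuclideanSpace ℝ (Fin n))}

lemma IsSymmetricConvexBody.neg_mem (hK : IsSymmetricConvexBody K) {x : EuclideanSpace ℝ (Fin n)}
    (hx : x ∈ K) : -x ∈ K := by
  rw [hK.symmetric] at hx; exact hx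

lemma IsSymmetricConvexBody.zero_mem_interior (hK : IsSymmetricConvexBody K) :
    (0 : EuclideanSpace ℝ (Fin n)) ∈ interior K := by
  obtain ⟨x, hx⟩ := hK.interior_nonempty
  have := hK.convex.combo_interior_self_mem_interior hx (hK.neg_mem (interior_subset hx))
    (a := (1 / 2 : ℝ)) (b := 1 / 2) (by norm_num) (by norm_num) (by norm_num)
  simpa using this

lemma isClosed_polarBody : IsClosed (polarBody K) := by
  have : polarBody K = ⋂ y ∈ K, {x | inner ℝ x y ≤ 1} := by
    ext x; simp [polarBody]
  rw [this]
  exact isClosed_biInter fun y _ => isClosed_le (by fun_prop) continuous_const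

lemma polarBody_closedBall {r : ℝ} (hr : 0 < r) :
    polarBody (Metric.closedBall (0 : EuclideanSpace ℝ (Fin n)) r) =
      Metric.closedBall 0 r⁻¹ := by
  ext x
  rw [mem_closedBall_zero_iff]
  constructor
  · intro hx
    rcases eq_or_ne x 0 with rfl | h0
    · simp [hr.le]
    have hpos : 0 < ‖x‖ := norm_pos_iff.2 h0
    have h := hx ((r / ‖x‖) • x) (by
      rw [mem_closedBall_zero_iff, norm_smul, Real.norm_of_nonneg (by positivity),
        div_mul_cancel₀ _ hpos.ne'])
    rw [real_inner_smul_right, real_inner_self_eq_norm_sq] at h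
    rw [le_inv_comm₀ hpos hr, ← one_div, le_div_iff₀ hpos]
    calc r * ‖x‖ = r / ‖x‖ * ‖x‖ ^ 2 := by field_simp
      _ ≤ 1 := h
  · intro hx y hy
    rw [mem_closedBall_zero_iff] at hy
    calc inner ℝ x y ≤ ‖x‖ * ‖y‖ := real_inner_le_norm x y
      _ ≤ r⁻¹ * r := by gcongr
      _ = 1 := inv_mul_cancel₀ hr.ne'

lemma polarBody_anti {L : Set (EuclideanSpace ℝ (Fin n))} (h : K ⊆ L) :
    polarBody L ⊆ polarBody K := fun _ hx y hy => hx y (h hy)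

lemma IsSymmetricConvexBody.polarBody (hK : IsSymmetricConvexBody K) :
    IsSymmetricConvexBody (polarBody K) where
  convex := by
    intro x hx y hy a b ha hb hab z hz
    rw [inner_add_left, real_inner_smul_left, real_inner_smul_left]
    have h1 := hx z hz
    have h2 := hy z hz
    nlinarith
  isCompact := by
    refine Metric.isCompact_of_isClosed_isBounded isClosed_polarBody ?_
    obtain ⟨ε, hε, hball⟩ := Metric.nhds_basis_closedBall.mem_iff.1
      (mem_interior_iff_mem_nhds.1 hK.zero_mem_interior)
    exact Metric.isBounded_closedBall.subset
      ((polarBody_anti hball).trans (polarBody_closedBall hε).subset)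
  interior_nonempty := by
    obtain ⟨R, hR, hKR⟩ := hK.isCompact.isBounded.subset_closedBall_lt 0 0
    refine ⟨0, interior_mono (polarBody_anti hKR) ?_⟩
    rw [polarBody_closedBall hR]
    exact mem_interior_iff_mem_nhds.2 (Metric.closedBall_mem_nhds _ (inv_pos.2 hR))
  symmetric := by
    ext x
    rw [Set.mem_neg]
    constructor
    · intro hx y hy
      have := hx (-y) (hK.neg_mem hy)
      rwa [inner_neg_right, ← inner_neg_left] at this
    · intro hx y hy
      have := hx (-y) (hK.neg_mem hy)
      rwa [inner_neg_neg] at this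

/-- The bipolar theorem for symmetric convex bodies. -/
lemma IsSymmetricConvexBody.polarBody_polarBody (hK : IsSymmetricConvexBody K) :
    _root_.polarBody (_root_.polarBody K) = K := by
  refine Subset.antisymm (fun x hx => ?_) fun x hx y hy => by
    rw [real_inner_comm]; exact hy x hx
  by_contra hxK
  obtain ⟨f, c, hfc, hcx⟩ := geometric_hahn_banach_closed_point hK.convex hK.isCompact.isClosed hxK
  have hc : 0 < c := by simpa using hfc 0 (interior_subset hK.zero_mem_interior)
  set y := (InnerProductSpace.toDual ℝ (EuclideanSpace ℝ (Fin n))).symm f with hy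
  have hyf : ∀ z, inner ℝ y z = f z := fun z => InnerProductSpace.toDual_symm_apply
  have hmem : c⁻¹ • y ∈ _root_.polarBody K := fun z hz => by
    rw [real_inner_smul_left, hyf, inv_mul_le_iff₀ hc, mul_one]
    exact (hfc z hz).le
  have h := hx _ hmem
  rw [real_inner_smul_right, real_inner_comm, hyf, inv_mul_le_iff₀ hc, mul_one] at h
  linarith

end Polar

/-! ### From the functional inequality to bodies -/

lemma exists_linearIsometryEquiv_apply_eq {E : Type*} [NormedAddCommGroup E]
    [InnerProductSpace ℝ E] [FiniteDimensional ℝ E] {v w : E} (h : ‖v‖ = ‖w‖) :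
    ∃ T : E ≃ₗᵢ[ℝ] E, T v = w :=
  ⟨_, Submodule.reflection_sub h⟩

/-- Orthonormal coordinates in which a given unit vector is the first basis vector. -/
lemma exists_chart {d : ℕ} {u : EuclideanSpace ℝ (Fin (d + 1))} (hu : ‖u‖ = 1) :
    ∃ Φ : EuclideanSpace ℝ (Fin (d + 1)) ≃L[ℝ] ℝ × EuclideanSpace ℝ (Fin d),
      MeasurePreserving Φ ∧ (∀ x, (Φ x).1 = inner ℝ x u) ∧
        ∀ x y, prodDot (Φ x) (Φ y) = inner ℝ x y := by
  obtain ⟨T, hT⟩ := exists_linearIsometryEquiv_apply_eq (v := u)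
    (w := EuclideanSpace.single 0 (1 : ℝ)) (by simp [hu])
  refine ⟨T.toContinuousLinearEquiv.trans (splitFst d),
    (measurePreserving_splitFst d).comp T.measurePreserving, fun x => ?_, fun x y => ?_⟩
  · have h := T.inner_map_map x u
    rw [hT, EuclideanSpace.inner_single_right] at h
    simpa [splitFst_apply] using h
  · simp only [ContinuousLinearEquiv.trans_apply]
    rw [prodDot_splitFst]
    exact T.inner_map_map x y

/-- The indicator of the part of a set in the half-space `t > 0`, read in a chart. -/
noncomputable def halfIndicator {X F : Type*} (L : Set X) (e : ℝ × F → X) : ℝ × F → ℝ :=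
  {v | e v ∈ L ∧ 0 < v.1}.indicator fun _ => 1

section Half

variable {d : ℕ} {L : Set (EuclideanSpace ℝ (Fin (d + 1)))}
  (Φ : EuclideanSpace ℝ (Fin (d + 1)) ≃L[ℝ] ℝ × EuclideanSpace ℝ (Fin d))

lemma isNice_halfIndicator (hLm : MeasurableSet L) (hLb : Bornology.IsBounded L) :
    IsNice (halfIndicator L Φ.symm) where
  measurable := measurable_const.indicator
    ((hLm.preimage Φ.symm.continuous.measurable).inter
      (measurableSet_lt measurable_const measurable_fst))
  nonneg := fun v => indicator_nonneg (fun _ _ => zero_le_one) v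
  bounded := ⟨1, fun v => indicator_le_self' (fun _ _ => zero_le_one) v⟩
  support := by
    refine ((hLb.isCompact_closure.image Φ.continuous).isBounded).subset fun v hv => ?_
    have h : v ∈ {v | Φ.symm v ∈ L ∧ 0 < v.1} := (support_indicator_subset) hv
    exact ⟨Φ.symm v, subset_closure h.1, Φ.apply_symm_apply v⟩

lemma integral_mul_halfIndicator (hΦ : MeasurePreserving Φ) (hLm : MeasurableSet L)
    (hLb : Bornology.IsBounded L) (hLs : ∀ x ∈ L, -x ∈ L)
    {h : ℝ × EuclideanSpace ℝ (Fin d) → ℝ} (hc : Continuous h) (heven : ∀ v, h (-v) = h v) :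
    ∫ v, h v * halfIndicator L Φ.symm v = (∫ x in L, h (Φ x)) / 2 := by
  set L' := Φ.symm ⁻¹' L with hL'
  have hL'm : MeasurableSet L' := hLm.preimage Φ.symm.continuous.measurable
  have hL's : ∀ v, -v ∈ L' ↔ v ∈ L' := fun v => by
    simp only [hL', mem_preimage, map_neg]
    exact ⟨fun hv => by simpa using hLs _ hv, hLs _⟩
  have hint : Integrable (L'.indicator h) := by
    rw [integrable_indicator_iff hL'm]
    have hcomp : IsCompact (Φ '' closure L) := hLb.isCompact_closure.image Φ.continuous
    refine (hc.continuousOn.integrableOn_compact hcomp).mono_set fun v hv => ?_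
    exact ⟨Φ.symm v, subset_closure hv, Φ.apply_symm_apply v⟩
  have htot : ∫ x in L, h (Φ x) = ∫ v, L'.indicator h v := by
    rw [integral_indicator hL'm, ← hΦ.setIntegral_preimage_emb
      Φ.toHomeomorph.measurableEmbedding]
    congr 2
    ext x; simp [hL']
  let ℓ := ContinuousLinearMap.fst ℝ ℝ (EuclideanSpace ℝ (Fin d))
  have hℓ : ℓ ≠ 0 := fun h0 => by
    have := DFunLike.congr_fun h0 (1, 0)
    simp [ℓ] at this
  have hneg : ∫ v in {v | ℓ v < 0}, L'.indicator h v = ∫ v in {v | 0 < ℓ v}, L'.indicator h v := by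
    have hmp : MeasurePreserving (Neg.neg : ℝ × EuclideanSpace ℝ (Fin d) → _) :=
      ((LinearIsometryEquiv.neg ℝ (E := ℝ)).measurePreserving).prod
        ((LinearIsometryEquiv.neg ℝ (E := EuclideanSpace ℝ (Fin d))).measurePreserving)
    rw [← hmp.setIntegral_preimage_emb (Homeomorph.neg _).measurableEmbedding]
    have hset : (Neg.neg ⁻¹' {v | ℓ v < 0} : Set (ℝ × EuclideanSpace ℝ (Fin d))) =
        {v | 0 < ℓ v} := by
      ext v; simp
    rw [hset]
    refine integral_congr_ae (ae_of_all _ fun v => ?_)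
    by_cases hv : v ∈ L'
    · simp [hv, (hL's v).2 hv, heven]
    · simp [hv, mt (hL's v).1 hv]
  have hpos : ∫ v, h v * halfIndicator L Φ.symm v = ∫ v in {v | 0 < ℓ v}, L'.indicator h v := by
    rw [← integral_indicator (measurableSet_lt measurable_const ℓ.continuous.measurable)]
    refine integral_congr_ae (ae_of_all _ fun v => ?_)
    by_cases h1 : Φ.symm v ∈ L <;> by_cases h2 : 0 < v.1 <;>
      simp [halfIndicator, hL', ℓ, h1, h2, indicator]
  rw [htot, integral_eq_add_of_linearMap volume ℓ hℓ hint, hneg, hpos]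
  ring

/-- The inequality for sets in duality, in the direction `u`. The hypothesis on the mixed moments
of `K` is the barycenter condition of the functional inequality. -/
lemma santaloBound_of_inner_le_one {K C : Set (EuclideanSpace ℝ (Fin (d + 1)))}
    (hKm : MeasurableSet K) (hKb : Bornology.IsBounded K) (hKs : ∀ x ∈ K, -x ∈ K)
    (hCm : MeasurableSet C) (hCb : Bornology.IsBounded C) (hCs : ∀ x ∈ C, -x ∈ C)
    (hKC : ∀ x ∈ K, ∀ y ∈ C, inner ℝ x y ≤ 1) {u : EuclideanSpace ℝ (Fin (d + 1))} (hu : ‖u‖ = 1)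
    (hmix : ∀ w, inner ℝ u w = 0 → ∫ x in K, inner ℝ x u * inner ℝ x w = 0) :
    SantaloBound ((∫ x in K, (inner ℝ x u) ^ 2) / 2) (volume.real K / 2)
      ((∫ x in C, (inner ℝ x u) ^ 2) / 2) (volume.real C / 2)
      ((∫ x in Metric.closedBall (0 : EuclideanSpace ℝ (Fin (d + 1))) 1, (inner ℝ x u) ^ 2) / 2)
      (volume.real (Metric.closedBall (0 : EuclideanSpace ℝ (Fin (d + 1))) 1) / 2) := by
  obtain ⟨Φ, hΦ, hΦ₁, hΦdot⟩ := exists_chart hu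
  have hmoment : ∀ {L : Set (EuclideanSpace ℝ (Fin (d + 1)))}, MeasurableSet L →
      Bornology.IsBounded L → (∀ x ∈ L, -x ∈ L) →
      ∫ v, v.1 ^ 2 * halfIndicator L Φ.symm v = (∫ x in L, (inner ℝ x u) ^ 2) / 2 := by
    intro L hm hb hs
    rw [integral_mul_halfIndicator Φ hΦ hm hb hs (h := fun v => v.1 ^ 2) (by fun_prop) (by simp)]
    simp only [hΦ₁]
  have hmass : ∀ {L : Set (EuclideanSpace ℝ (Fin (d + 1)))}, MeasurableSet L →
      Bornology.IsBounded L → (∀ x ∈ L, -x ∈ L) →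
      ∫ v, halfIndicator L Φ.symm v = volume.real L / 2 := by
    intro L hm hb hs
    have := integral_mul_halfIndicator Φ hΦ hm hb hs (h := fun _ => 1) (by fun_prop) (by simp)
    simpa using this
  have hball : ∀ v : ℝ × EuclideanSpace ℝ (Fin d), 0 < v.1 →
      (Ioc (0 : ℝ) 1).indicator (fun _ => (1 : ℝ)) (v.1 ^ 2 + inner ℝ v.2 v.2) =
        halfIndicator (Metric.closedBall 0 1) Φ.symm v := by
    intro v hv
    have h1 : v.1 ^ 2 + inner ℝ v.2 v.2 = ‖Φ.symm v‖ ^ 2 := by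
      rw [← real_inner_self_eq_norm_sq, ← hΦdot, Φ.apply_symm_apply, prodDot, sq]
    have h2 : 0 < ‖Φ.symm v‖ ^ 2 := by
      rw [← h1]; exact add_pos_of_pos_of_nonneg (by positivity) real_inner_self_nonneg
    have h3 : ‖Φ.symm v‖ ^ 2 ≤ 1 ↔ ‖Φ.symm v‖ ≤ 1 := by
      rw [sq_le_one_iff₀ (norm_nonneg _)]
    rw [h1]
    by_cases hn : ‖Φ.symm v‖ ≤ 1
    · simp [halfIndicator, indicator, h2, h3, hn, hv]
    · simp [halfIndicator, indicator, h3, hn]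
  have hS : MeasurableSet {v : ℝ × EuclideanSpace ℝ (Fin d) | 0 < v.1} :=
    measurableSet_lt measurable_const measurable_fst
  have hrad : ∀ g : ℝ → ℝ, ∫ v in {v : ℝ × EuclideanSpace ℝ (Fin d) | 0 < v.1},
      g v.1 * (Ioc (0 : ℝ) 1).indicator (fun _ => (1 : ℝ)) (v.1 ^ 2 + inner ℝ v.2 v.2) =
        ∫ v, g v.1 * halfIndicator (Metric.closedBall 0 1) Φ.symm v := fun g => by
    rw [← integral_indicator hS]
    refine integral_congr_ae (ae_of_all _ fun v => ?_)
    by_cases hv : 0 < v.1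
    · rw [indicator_of_mem (show v ∈ {v : ℝ × EuclideanSpace ℝ (Fin d) | 0 < v.1} from hv), hball v hv]
    · simp [hv, halfIndicator]
  have hBs : ∀ x ∈ Metric.closedBall (0 : EuclideanSpace ℝ (Fin (d + 1))) 1,
      -x ∈ Metric.closedBall (0 : EuclideanSpace ℝ (Fin (d + 1))) 1 := fun x hx => by simpa using hx
  have hθ : IsNice ((Ioc (0 : ℝ) 1).indicator fun _ => (1 : ℝ)) :=
    { measurable := measurable_const.indicator measurableSet_Ioc
      nonneg := fun v => indicator_nonneg (fun _ _ => zero_le_one) v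
      bounded := ⟨1, fun v => indicator_le_self' (fun _ _ => zero_le_one) v⟩
      support := (Metric.isBounded_Ioc 0 1).subset support_indicator_subset }
  have key := santaloInequality_euclidean d _ _ _ hθ (isNice_halfIndicator Φ hKm hKb)
    (isNice_halfIndicator Φ hCm hCb) (fun v hv => by simp [halfIndicator, not_lt.2 hv])
    (fun v hv => by simp [halfIndicator, not_lt.2 hv]) ?_ ?_
  · have h1 := hrad fun t => t ^ 2
    have h2 := hrad fun _ => 1
    simp only [one_mul] at h2
    rw [radialMoment, radialMass, h1, h2, hmoment hKm hKb hKs, hmoment hCm hCb hCs,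
      hmass hKm hKb hKs, hmass hCm hCb hCs,
      hmoment Metric.isClosed_closedBall.measurableSet Metric.isBounded_closedBall hBs,
      hmass Metric.isClosed_closedBall.measurableSet Metric.isBounded_closedBall hBs] at key
    exact key
  · intro v w hv hw hvw
    by_cases h1 : Φ.symm v ∈ K
    · by_cases h2 : Φ.symm w ∈ C
      · have h3 : v.1 * w.1 + inner ℝ v.2 w.2 ≤ 1 := by
          have := hKC _ h1 _ h2
          rwa [← hΦdot, Φ.apply_symm_apply, Φ.apply_symm_apply] at this
        simp [halfIndicator, indicator, h1, h2, hv, hw, hvw, h3]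
      · simp [halfIndicator, h2, sq_nonneg]
    · simp [halfIndicator, h1, sq_nonneg]
  · -- the barycenter condition is tested against a vector `c` of the hyperplane
    refine ext_inner_left ℝ fun c => ?_
    rw [inner_zero_right, ← integral_inner ((isNice_halfIndicator Φ hKm hKb).integrable_smul volume
      (w := fun v => v.1 • v.2) (by fun_prop))]
    have h1 := integral_mul_halfIndicator Φ hΦ hKm hKb hKs
      (h := fun v => v.1 * inner ℝ c v.2) (by fun_prop) (by simp)
    have h2 : ∀ x, inner ℝ c (Φ x).2 = inner ℝ x (Φ.symm (0, c)) := fun x => by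
      rw [← hΦdot, Φ.apply_symm_apply, prodDot]
      simp [real_inner_comm]
    simp only [h2, hΦ₁] at h1
    rw [hmix _ (by rw [real_inner_comm, ← hΦ₁, Φ.apply_symm_apply]), zero_div] at h1
    rw [← h1]
    refine integral_congr_ae (ae_of_all _ fun v => ?_)
    simp only [inner_smul_right]
    ring

end Half

/-! ### Moments of convex bodies and the case of equality -/

section Moments

variable {d : ℕ}

lemma integrableOn_of_isBounded {L : Set (EuclideanSpace ℝ (Fin (d + 1)))}
    (hL : Bornology.IsBounded L) {f : EuclideanSpace ℝ (Fin (d + 1)) → ℝ} (hf : Continuous f) :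
    IntegrableOn f L :=
  (hf.continuousOn.integrableOn_compact hL.isCompact_closure).mono_set subset_closure

lemma sum_setIntegral_inner_sq {L : Set (EuclideanSpace ℝ (Fin (d + 1)))}
    (hL : Bornology.IsBounded L) :
    ∑ i, ∫ x in L, (inner ℝ x (EuclideanSpace.basisFun (Fin (d + 1)) ℝ i)) ^ 2 =
      ∫ x in L, ‖x‖ ^ 2 := by
  rw [← integral_finsetSum _ fun i _ => integrableOn_of_isBounded hL (by fun_prop)]
  refine integral_congr_ae (ae_of_all _ fun x => ?_)
  simp only [← (EuclideanSpace.basisFun (Fin (d + 1)) ℝ).sum_sq_inner_left x]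

lemma setIntegral_closedBall_inner_sq_congr {v w : EuclideanSpace ℝ (Fin (d + 1))} (r : ℝ)
    (h : ‖v‖ = ‖w‖) :
    ∫ x in Metric.closedBall (0 : EuclideanSpace ℝ (Fin (d + 1))) r, (inner ℝ x v) ^ 2 =
      ∫ x in Metric.closedBall (0 : EuclideanSpace ℝ (Fin (d + 1))) r, (inner ℝ x w) ^ 2 := by
  obtain ⟨T, hT⟩ := exists_linearIsometryEquiv_apply_eq h
  rw [← (T.measurePreserving).setIntegral_preimage_emb T.toHomeomorph.measurableEmbedding
    (fun x => (inner ℝ x w) ^ 2)]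
  simp [← hT, T.inner_map_map]

lemma setIntegral_inner_smul_sq (L : Set (EuclideanSpace ℝ (Fin (d + 1)))) (c : ℝ)
    (u : EuclideanSpace ℝ (Fin (d + 1))) :
    ∫ x in L, (inner ℝ x (c • u)) ^ 2 = c ^ 2 * ∫ x in L, (inner ℝ x u) ^ 2 := by
  rw [← integral_const_mul]
  simp only [real_inner_smul_right, mul_pow]

lemma isIsotropicBody_closedBall (r : ℝ) :
    IsIsotropicBody (Metric.closedBall (0 : EuclideanSpace ℝ (Fin (d + 1))) r) := by
  intro w
  rw [← sum_setIntegral_inner_sq Metric.isBounded_closedBall, Finset.mul_sum]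
  have h : ∀ i, ‖w‖ ^ 2 / ((d + 1 : ℕ) : ℝ) *
      ∫ x in Metric.closedBall (0 : EuclideanSpace ℝ (Fin (d + 1))) r,
        (inner ℝ x (EuclideanSpace.basisFun (Fin (d + 1)) ℝ i)) ^ 2 =
      (∫ x in Metric.closedBall (0 : EuclideanSpace ℝ (Fin (d + 1))) r, (inner ℝ x w) ^ 2) /
        ((d + 1 : ℕ) : ℝ) := fun i => by
    rw [setIntegral_closedBall_inner_sq_congr r (v := w)
      (w := ‖w‖ • EuclideanSpace.basisFun (Fin (d + 1)) ℝ i) (by simp [norm_smul]),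
      setIntegral_inner_smul_sq]
    ring
  simp only [h, Finset.sum_const, Finset.card_univ, Fintype.card_fin, nsmul_eq_mul]
  field_simp

lemma setIntegral_closedBall_homogeneous {f : EuclideanSpace ℝ (Fin (d + 1)) → ℝ}
    (hf : ∀ (c : ℝ) x, f (c • x) = c ^ 2 * f x) {r : ℝ} (hr : 0 < r) :
    ∫ x in Metric.closedBall (0 : EuclideanSpace ℝ (Fin (d + 1))) r, f x =
      r ^ (d + 3) * ∫ x in Metric.closedBall (0 : EuclideanSpace ℝ (Fin (d + 1))) 1, f x := by
  have h := Measure.setIntegral_comp_smul_of_pos volume f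
    (Metric.closedBall (0 : EuclideanSpace ℝ (Fin (d + 1))) 1) hr
  rw [smul_closedBall _ _ zero_le_one, smul_zero, Real.norm_of_nonneg hr.le, mul_one,
    finrank_euclideanSpace_fin, smul_eq_mul] at h
  simp only [hf] at h
  rw [integral_const_mul, eq_inv_mul_iff_mul_eq₀ (by positivity)] at h
  rw [← h]
  ring

lemma volume_real_closedBall {r : ℝ} (hr : 0 ≤ r) :
    volume.real (Metric.closedBall (0 : EuclideanSpace ℝ (Fin (d + 1))) r) =
      r ^ (d + 1) * volume.real (Metric.closedBall (0 : EuclideanSpace ℝ (Fin (d + 1))) 1) := by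
  rw [Measure.real, Measure.addHaar_closedBall _ _ hr, Measure.real,
    Measure.addHaar_closedBall _ _ zero_le_one, finrank_euclideanSpace_fin]
  simp [ENNReal.toReal_mul, hr]

lemma volume_real_closedBall_one_pos :
    0 < volume.real (Metric.closedBall (0 : EuclideanSpace ℝ (Fin (d + 1))) 1) := by
  rw [Measure.real, ENNReal.toReal_pos_iff]
  exact ⟨Metric.measure_closedBall_pos _ _ one_pos, measure_closedBall_lt_top⟩

lemma exists_radius {L : Set (EuclideanSpace ℝ (Fin (d + 1)))} (hL : 0 < volume.real L) :
    ∃ r : ℝ, 0 < r ∧ volume.real (Metric.closedBall (0 : EuclideanSpace ℝ (Fin (d + 1))) r) =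
      volume.real L := by
  have hB := volume_real_closedBall_one_pos (d := d)
  have hpos := div_pos hL hB
  refine ⟨(volume.real L / volume.real
    (Metric.closedBall (0 : EuclideanSpace ℝ (Fin (d + 1))) 1)) ^ ((d + 1 : ℕ) : ℝ)⁻¹,
    Real.rpow_pos_of_pos hpos _, ?_⟩
  rw [volume_real_closedBall (Real.rpow_nonneg hpos.le _),
    Real.rpow_inv_natCast_pow hpos.le d.succ_ne_zero, div_mul_cancel₀ _ hB.ne']

lemma subset_of_measure_sdiff_eq_zero {L M : Set (EuclideanSpace ℝ (Fin (d + 1)))}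
    (hL : L ⊆ closure (interior L)) (hM : IsClosed M) (h : volume (L \ M) = 0) : L ⊆ M := by
  have hint : interior L ⊆ M := by
    by_contra hcon
    obtain ⟨x, hx, hxM⟩ := not_subset.1 hcon
    have hopen : IsOpen (interior L \ M) := isOpen_interior.sdiff hM
    exact (hopen.measure_pos volume ⟨x, hx, hxM⟩).ne'
      (measure_mono_null (sdiff_subset_sdiff_left interior_subset) h)
  exact hL.trans (closure_minimal hint hM)

/-- Among bodies of given volume, the centered ball is the only one with least moment
`∫ ‖x‖²`. -/
lemma moment_closedBall_le {L : Set (EuclideanSpace ℝ (Fin (d + 1)))} (hconv : Convex ℝ L)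
    (hcomp : IsCompact L) (hne : (interior L).Nonempty) {r : ℝ} (hr : 0 < r)
    (hvol : volume.real (Metric.closedBall (0 : EuclideanSpace ℝ (Fin (d + 1))) r) =
      volume.real L) :
    ∫ x in Metric.closedBall (0 : EuclideanSpace ℝ (Fin (d + 1))) r, ‖x‖ ^ 2 ≤
      ∫ x in L, ‖x‖ ^ 2 ∧
    (∫ x in L, ‖x‖ ^ 2 = ∫ x in Metric.closedBall (0 : EuclideanSpace ℝ (Fin (d + 1))) r, ‖x‖ ^ 2 →
      L = Metric.closedBall 0 r) := by
  set D := Metric.closedBall (0 : EuclideanSpace ℝ (Fin (d + 1))) r with hD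
  have hLm : MeasurableSet L := hcomp.isClosed.measurableSet
  have hDm : MeasurableSet D := Metric.isClosed_closedBall.measurableSet
  set f : EuclideanSpace ℝ (Fin (d + 1)) → ℝ := fun x => ‖x‖ ^ 2 - r ^ 2 with hf
  have hfi : ∀ {M : Set (EuclideanSpace ℝ (Fin (d + 1)))}, Bornology.IsBounded M →
      IntegrableOn f M := fun hM => integrableOn_of_isBounded hM (by fun_prop)
  have hfint : ∀ {M : Set (EuclideanSpace ℝ (Fin (d + 1)))}, Bornology.IsBounded M →
      ∫ x in M, f x = (∫ x in M, ‖x‖ ^ 2) - r ^ 2 * volume.real M := fun {M} hM => by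
    rw [hf, integral_sub (integrableOn_of_isBounded hM (by fun_prop))
      (integrableOn_of_isBounded hM (by fun_prop)), setIntegral_const, smul_eq_mul, mul_comm (r ^ 2)]
  have hLi := (integrable_indicator_iff hLm).2 (hfi hcomp.isBounded)
  have hDi := (integrable_indicator_iff hDm).2 (hfi (Metric.isBounded_closedBall (x := 0) (r := r)))
  -- `1_L - 1_D` and `‖x‖² - r²` have the same sign at every point
  set g := fun x => L.indicator f x - D.indicator f x with hg
  have hgi : Integrable g := hLi.sub hDi
  have hg0 : ∀ x, 0 ≤ g x := fun x => by
    have hxD : x ∈ D ↔ ‖x‖ ≤ r := mem_closedBall_zero_iff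
    by_cases h1 : x ∈ L <;> by_cases h2 : x ∈ D
    · simp [hg, h1, h2]
    · have := not_le.1 (mt hxD.2 h2)
      simp only [hg, h1, h2, indicator_of_mem, indicator_of_notMem, not_false_eq_true, hf]
      nlinarith
    · have := hxD.1 h2
      simp only [hg, h1, h2, indicator_of_mem, indicator_of_notMem, not_false_eq_true, hf]
      nlinarith [norm_nonneg x]
    · simp [hg, h1, h2]
  have hgint : ∫ x, g x = (∫ x in L, ‖x‖ ^ 2) - ∫ x in D, ‖x‖ ^ 2 := by
    rw [hg, integral_sub hLi hDi, integral_indicator hLm, integral_indicator hDm,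
      hfint hcomp.isBounded, hfint Metric.isBounded_closedBall, hvol]
    ring
  refine ⟨by linarith [integral_nonneg (μ := volume) (f := g) hg0], fun heq => ?_⟩
  rw [heq, sub_self, integral_eq_zero_iff_of_nonneg hg0 hgi] at hgint
  have hsphere : ∀ᵐ x : EuclideanSpace ℝ (Fin (d + 1)), x ∉ Metric.sphere 0 r :=
    measure_eq_zero_iff_ae_notMem.1 (Measure.addHaar_sphere volume 0 r)
  have hae : ∀ᵐ x : EuclideanSpace ℝ (Fin (d + 1)), x ∈ L ↔ x ∈ D := by
    filter_upwards [hgint, hsphere] with x hx hxs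
    have hne : f x ≠ 0 := fun h0 => hxs (by
      rw [mem_sphere_zero_iff_norm]
      exact (sq_eq_sq₀ (norm_nonneg x) hr.le).1 (sub_eq_zero.1 h0))
    by_cases h1 : x ∈ L <;> by_cases h2 : x ∈ D <;> simp_all
  have hcl : ∀ {M : Set (EuclideanSpace ℝ (Fin (d + 1)))}, Convex ℝ M → (interior M).Nonempty →
      M ⊆ closure (interior M) := fun hM hMi => by
    rw [hM.closure_interior_eq_closure_of_nonempty_interior hMi]; exact subset_closure
  refine Subset.antisymm ?_ ?_
  · refine subset_of_measure_sdiff_eq_zero (hcl hconv hne) Metric.isClosed_closedBall ?_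
    refine measure_eq_zero_iff_ae_notMem.2 ?_
    filter_upwards [hae] with x hx h using h.2 (hx.1 h.1)
  · refine subset_of_measure_sdiff_eq_zero (hcl (convex_closedBall 0 r)
      ⟨0, mem_interior_iff_mem_nhds.2 (Metric.closedBall_mem_nhds _ hr)⟩) hcomp.isClosed ?_
    refine measure_eq_zero_iff_ae_notMem.2 ?_
    filter_upwards [hae] with x hx h using h.2 (hx.2 h.1)

/-- Polarization of the isotropy condition: the mixed moments vanish in orthogonal directions. -/
lemma IsIsotropicBody.setIntegral_inner_mul_inner {K : Set (EuclideanSpace ℝ (Fin (d + 1)))}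
    (hK : IsIsotropicBody K) (hKb : Bornology.IsBounded K) {u w : EuclideanSpace ℝ (Fin (d + 1))}
    (h : inner ℝ u w = 0) : ∫ x in K, inner ℝ x u * inner ℝ x w = 0 := by
  have hnorm : ‖u + w‖ ^ 2 = ‖u - w‖ ^ 2 := by
    rw [norm_add_sq_real, norm_sub_sq_real, h]; ring
  have h1 := hK (u + w)
  rw [hnorm, ← hK (u - w), ← sub_eq_zero,
    ← integral_sub (integrableOn_of_isBounded hKb (by fun_prop))
      (integrableOn_of_isBounded hKb (by fun_prop))] at h1
  have h2 : ∀ x, (inner ℝ x (u + w)) ^ 2 - (inner ℝ x (u - w)) ^ 2 =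
      4 * (inner ℝ x u * inner ℝ x w : ℝ) := fun x => by
    rw [inner_add_right, inner_sub_right]; ring
  simp only [h2, integral_const_mul] at h1
  linarith

lemma IsSymmetricConvexBody.volume_real_pos {K : Set (EuclideanSpace ℝ (Fin (d + 1)))}
    (hK : IsSymmetricConvexBody K) : 0 < volume.real K := by
  rw [Measure.real, ENNReal.toReal_pos_iff]
  exact ⟨(isOpen_interior.measure_pos volume hK.interior_nonempty).trans_le
    (measure_mono interior_subset), hK.isCompact.measure_lt_top⟩

lemma moment_closedBall_pos :
    0 < ∫ x in Metric.closedBall (0 : EuclideanSpace ℝ (Fin (d + 1))) 1, ‖x‖ ^ 2 := by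
  have hint : IntegrableOn (fun x : EuclideanSpace ℝ (Fin (d + 1)) => ‖x‖ ^ 2)
    (Metric.closedBall 0 1) := integrableOn_of_isBounded Metric.isBounded_closedBall (by fun_prop)
  rw [setIntegral_pos_iff_support_of_nonneg_ae (ae_of_all _ fun x => sq_nonneg _) hint]
  have hsub : Metric.ball (0 : EuclideanSpace ℝ (Fin (d + 1))) 1 \ {0} ⊆
      Function.support (fun x : EuclideanSpace ℝ (Fin (d + 1)) => ‖x‖ ^ 2) ∩
        Metric.closedBall 0 1 := fun x hx =>
    ⟨pow_ne_zero 2 (norm_ne_zero_iff.2 hx.2), Metric.ball_subset_closedBall hx.1⟩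
  refine lt_of_lt_of_le ?_ (measure_mono hsub)
  rw [measure_sdiff_null (measure_singleton _)]
  exact Metric.measure_ball_pos _ _ one_pos

/-- The inequality in a unit direction `u`, together with the consequence for volumes in the case of
equality. -/
lemma IsSymmetricConvexBody.santaloBound {K : Set (EuclideanSpace ℝ (Fin (d + 1)))}
    (hK : IsSymmetricConvexBody K) (hiso : IsIsotropicBody K)
    {u : EuclideanSpace ℝ (Fin (d + 1))} (hu : ‖u‖ = 1) :
    SantaloBound ((∫ x in K, (inner ℝ x u) ^ 2) / 2) (volume.real K / 2)
      ((∫ x in _root_.polarBody K, (inner ℝ x u) ^ 2) / 2) (volume.real (_root_.polarBody K) / 2)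
      ((∫ x in Metric.closedBall (0 : EuclideanSpace ℝ (Fin (d + 1))) 1, (inner ℝ x u) ^ 2) / 2)
      (volume.real (Metric.closedBall (0 : EuclideanSpace ℝ (Fin (d + 1))) 1) / 2) :=
  santaloBound_of_inner_le_one hK.isCompact.isClosed.measurableSet hK.isCompact.isBounded
    (fun _ => hK.neg_mem) hK.polarBody.isCompact.isClosed.measurableSet
    hK.polarBody.isCompact.isBounded (fun _ => hK.polarBody.neg_mem)
    (fun x hx y hy => by rw [real_inner_comm]; exact hy x hx) hu
    fun _ hw => hiso.setIntegral_inner_mul_inner hK.isCompact.isBounded hw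

/-- An isotropic body whose volume product is at least that of the Euclidean ball is a ball: the
inequality, summed over an orthonormal basis, bounds the product of the moments `∫ ‖x‖²`, and these
are minimized by balls for given volumes. -/
lemma IsSymmetricConvexBody.eq_closedBall {K : Set (EuclideanSpace ℝ (Fin (d + 1)))}
    (hK : IsSymmetricConvexBody K) (hiso : IsIsotropicBody K)
    (hvol : volume.real (Metric.closedBall (0 : EuclideanSpace ℝ (Fin (d + 1))) 1) ^ 2 ≤
      volume.real K * volume.real (_root_.polarBody K)) :
    ∃ r : ℝ, 0 < r ∧ K = Metric.closedBall 0 r := by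
  have hC := hK.polarBody
  set C := _root_.polarBody K with hCdef
  set SB := ∫ x in Metric.closedBall (0 : EuclideanSpace ℝ (Fin (d + 1))) 1, ‖x‖ ^ 2 with hSB
  set SK := ∫ x in K, ‖x‖ ^ 2 with hSK
  set SC := ∫ x in C, ‖x‖ ^ 2 with hSC
  have hSBpos : 0 < SB := moment_closedBall_pos
  have hn : (0 : ℝ) < ((d + 1 : ℕ) : ℝ) := by positivity
  have hprod : SK * SC ≤ SB ^ 2 := by
    have hi : ∀ i : Fin (d + 1), SK / ((d + 1 : ℕ) : ℝ) *
        ∫ x in C, (inner ℝ x (EuclideanSpace.basisFun (Fin (d + 1)) ℝ i)) ^ 2 ≤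
          (SB / ((d + 1 : ℕ) : ℝ)) ^ 2 := fun i => by
      have hu : ‖EuclideanSpace.basisFun (Fin (d + 1)) ℝ i‖ = 1 := by simp
      have h := (hK.santaloBound hiso hu).1
      rw [hiso, isIsotropicBody_closedBall, hu] at h
      have h1 : (1 : ℝ) ^ 2 / ((d + 1 : ℕ) : ℝ) * SK = SK / ((d + 1 : ℕ) : ℝ) := by ring
      have h2 : (1 : ℝ) ^ 2 / ((d + 1 : ℕ) : ℝ) * SB = SB / ((d + 1 : ℕ) : ℝ) := by ring
      rw [h1, h2] at h
      linarith
    have hs := Finset.sum_le_sum fun i (_ : i ∈ Finset.univ) => hi i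
    rw [← Finset.mul_sum, sum_setIntegral_inner_sq hC.isCompact.isBounded, Finset.sum_const,
      Finset.card_univ, Fintype.card_fin, nsmul_eq_mul, div_pow, div_mul_eq_mul_div,
      div_le_iff₀ hn] at hs
    calc SK * SC ≤ _ := hs
      _ = SB ^ 2 := by field_simp
  obtain ⟨a, ha, hav⟩ := exists_radius hK.volume_real_pos
  obtain ⟨b, hb, hbv⟩ := exists_radius hC.volume_real_pos
  obtain ⟨hKle, hKeq⟩ := moment_closedBall_le hK.convex hK.isCompact hK.interior_nonempty ha hav
  obtain ⟨hCle, -⟩ := moment_closedBall_le hC.convex hC.isCompact hC.interior_nonempty hb hbv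
  have hhom : ∀ (c : ℝ) (x : EuclideanSpace ℝ (Fin (d + 1))), ‖c • x‖ ^ 2 = c ^ 2 * ‖x‖ ^ 2 :=
    fun c x => by rw [norm_smul, mul_pow, Real.norm_eq_abs, sq_abs]
  have hSa := setIntegral_closedBall_homogeneous (f := fun x => ‖x‖ ^ 2) hhom ha
  have hSb := setIntegral_closedBall_homogeneous (f := fun x => ‖x‖ ^ 2) hhom hb
  rw [hSa] at hKle hKeq
  rw [hSb] at hCle
  have hab : 1 ≤ a * b := by
    rw [← hav, ← hbv, volume_real_closedBall ha.le, volume_real_closedBall hb.le] at hvol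
    have hVpos := volume_real_closedBall_one_pos (d := d)
    have h1 : 1 ≤ (a * b) ^ (d + 1) := by
      rw [mul_pow]
      by_contra hlt
      nlinarith [mul_lt_mul_of_pos_right (not_le.1 hlt) (pow_pos hVpos 2)]
    by_contra hlt
    exact absurd h1 (not_le.2 (pow_lt_one₀ (by positivity) (not_le.1 hlt) d.succ_ne_zero))
  refine ⟨a, ha, hKeq (le_antisymm ?_ hKle)⟩
  have hpow : 1 ≤ (a * b) ^ (d + 3) := one_le_pow₀ hab
  rw [mul_pow] at hpow
  have hbpos : 0 < b ^ (d + 3) := by positivity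
  have hSK0 : 0 ≤ SK := integral_nonneg fun x => sq_nonneg _
  have h1 : SK * (b ^ (d + 3) * SB) ≤ SB ^ 2 := (mul_le_mul_of_nonneg_left hCle hSK0).trans hprod
  have h2 : SK * b ^ (d + 3) ≤ SB := by
    refine le_of_mul_le_mul_right ?_ hSBpos
    calc SK * b ^ (d + 3) * SB = SK * (b ^ (d + 3) * SB) := by ring
      _ ≤ SB ^ 2 := h1
      _ = SB * SB := sq SB
  refine le_of_mul_le_mul_right ?_ hbpos
  calc SK * b ^ (d + 3) ≤ SB := h2
    _ ≤ a ^ (d + 3) * b ^ (d + 3) * SB := le_mul_of_one_le_left hSBpos.le hpow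
    _ = a ^ (d + 3) * SB * b ^ (d + 3) := by ring

/-- The theorem in the case where `K` itself is isotropic; the other case follows by duality. -/
lemma IsSymmetricConvexBody.santalo_of_isIsotropicBody
    {K : Set (EuclideanSpace ℝ (Fin (d + 1)))} (hK : IsSymmetricConvexBody K)
    (hiso : IsIsotropicBody K) {u : EuclideanSpace ℝ (Fin (d + 1))} (hu : u ≠ 0) :
    (∫ x in K, (inner ℝ x u) ^ 2) * (∫ x in _root_.polarBody K, (inner ℝ x u) ^ 2)
        ≤ (∫ x in Metric.closedBall (0 : EuclideanSpace ℝ (Fin (d + 1))) 1,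
          (inner ℝ x u) ^ 2) ^ 2 ∧
    ((∫ x in K, (inner ℝ x u) ^ 2) * (∫ x in _root_.polarBody K, (inner ℝ x u) ^ 2)
        = (∫ x in Metric.closedBall (0 : EuclideanSpace ℝ (Fin (d + 1))) 1,
          (inner ℝ x u) ^ 2) ^ 2 ↔
      ∃ r : ℝ, 0 < r ∧ K = Metric.closedBall (0 : EuclideanSpace ℝ (Fin (d + 1))) r) := by
  have hupos : 0 < ‖u‖ := norm_pos_iff.2 hu
  obtain ⟨e, hen, hue⟩ : ∃ e : EuclideanSpace ℝ (Fin (d + 1)), ‖e‖ = 1 ∧ u = ‖u‖ • e :=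
    ⟨‖u‖⁻¹ • u, by rw [norm_smul, norm_inv, norm_norm, inv_mul_cancel₀ hupos.ne'],
      by rw [smul_inv_smul₀ hupos.ne']⟩
  have hscale : ∀ L : Set (EuclideanSpace ℝ (Fin (d + 1))), ∫ x in L, (inner ℝ x u) ^ 2 =
      ‖u‖ ^ 2 * ∫ x in L, (inner ℝ x e) ^ 2 := fun L => by
    conv_lhs => rw [hue]
    rw [setIntegral_inner_smul_sq]
  obtain ⟨h1, h2⟩ := hK.santaloBound hiso hen
  have h4 : 0 < (‖u‖ ^ 2) ^ 2 := by positivity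
  have hQB : 0 < ∫ x in Metric.closedBall (0 : EuclideanSpace ℝ (Fin (d + 1))) 1,
      (inner ℝ x e) ^ 2 := by
    rw [isIsotropicBody_closedBall 1 e, hen]
    exact mul_pos (by positivity) moment_closedBall_pos
  -- both sides are homogeneous in `u`
  have hreal : ∀ {p q b : ℝ}, (p / 2) * (q / 2) ≤ (b / 2) ^ 2 →
      ‖u‖ ^ 2 * p * (‖u‖ ^ 2 * q) ≤ (‖u‖ ^ 2 * b) ^ 2 := fun {p q b} h => by
    have h3 := mul_le_mul_of_nonneg_left h h4.le
    linarith
  have hreal' : ∀ {p q b : ℝ}, ‖u‖ ^ 2 * p * (‖u‖ ^ 2 * q) = (‖u‖ ^ 2 * b) ^ 2 →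
      (p / 2) * (q / 2) = (b / 2) ^ 2 := fun {p q b} h =>
    mul_left_cancel₀ h4.ne' (by linear_combination h / 4)
  have hvol : ∀ {p q b : ℝ}, (b / 2) ^ 2 ≤ (p / 2) * (q / 2) → b ^ 2 ≤ p * q := fun h => by
    linarith
  refine ⟨?_, fun heq => ?_, ?_⟩
  · rw [hscale, hscale, hscale]
    exact hreal h1
  · rw [hscale, hscale, hscale] at heq
    exact hK.eq_closedBall hiso (hvol (h2 (half_pos hQB) (hreal' heq)))
  · rintro ⟨r, hr, rfl⟩
    have hhom : ∀ (c : ℝ) (x : EuclideanSpace ℝ (Fin (d + 1))),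
        (inner ℝ (c • x) u : ℝ) ^ 2 = c ^ 2 * (inner ℝ x u : ℝ) ^ 2 :=
      fun c x => by rw [real_inner_smul_left, mul_pow]
    rw [polarBody_closedBall hr,
      setIntegral_closedBall_homogeneous (f := fun x => (inner ℝ x u) ^ 2) hhom hr,
      setIntegral_closedBall_homogeneous (f := fun x => (inner ℝ x u) ^ 2) hhom (inv_pos.2 hr)]
    have : r ^ (d + 3) * r⁻¹ ^ (d + 3) = 1 := by
      rw [← mul_pow, mul_inv_cancel₀ hr.ne', one_pow]
    rw [mul_mul_mul_comm, this, one_mul, sq]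

end Moments

end BlaschkeSantalo

theorem mainTheorem2 {n : ℕ} (K : Set (EuclideanSpace ℝ (Fin n)))
    (hK : IsSymmetricConvexBody K)
    (hiso : IsIsotropicBody K ∨ IsIsotropicBody (polarBody K))
    (u : EuclideanSpace ℝ (Fin n)) (hu : u ≠ 0) :
    (∫ x in K, (inner ℝ x u) ^ 2) * (∫ x in polarBody K, (inner ℝ x u) ^ 2)
        ≤ (∫ x in Metric.closedBall (0 : EuclideanSpace ℝ (Fin n)) 1, (inner ℝ x u) ^ 2) ^ 2 ∧
    ((∫ x in K, (inner ℝ x u) ^ 2) * (∫ x in polarBody K, (inner ℝ x u) ^ 2)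
        = (∫ x in Metric.closedBall (0 : EuclideanSpace ℝ (Fin n)) 1, (inner ℝ x u) ^ 2) ^ 2 ↔
      ∃ r : ℝ, 0 < r ∧ K = Metric.closedBall (0 : EuclideanSpace ℝ (Fin n)) r) := by
  rcases n with _ | d
  · exact absurd (Subsingleton.elim u 0) hu
  rcases hiso with hiso | hiso
  · exact hK.santalo_of_isIsotropicBody hiso hu
  · have h := hK.polarBody.santalo_of_isIsotropicBody hiso hu
    rw [hK.polarBody_polarBody, mul_comm] at h
    refine ⟨h.1, h.2.trans ⟨?_, ?_⟩⟩
    · rintro ⟨r, hr, hKr⟩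
      exact ⟨r⁻¹, inv_pos.2 hr, by
        rw [← hK.polarBody_polarBody, hKr, polarBody_closedBall hr]⟩
    · rintro ⟨r, hr, hKr⟩
      exact ⟨r⁻¹, inv_pos.2 hr, by rw [hKr, polarBody_closedBall hr]⟩
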